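/- Let $0<d<\pi/2$ and put $\mathscr{D}_d=\{\zeta\in\mathbb{C}:|\operatorname{Im}\zeta|<d\}$, $\mathscr{D}_d^{-}=\{\zeta\in\mathscr{D}_d:\operatorname{Re}\zeta<0\}$, $\mathscr{D}_d^{+}=\{\zeta\in\mathscr{D}_d:\operatorname{Re}\zeta\ge 0\}$. Let $\psi(x)=\sinh x$, so that $\psi'(x)=\cosh x$ and $\psi^{-1}=\operatorname{arcsinh}$ on $\mathbb{R}$, and let $E_1(z;\gamma)=(1+z^2)^{-(\gamma+1)/2}$. For an integer $k$ and $h>0$ let $$J(k,h)(x)=h\left\{\frac12+\frac1\pi\operatorname{Si}[\pi(x/h-k)]\right\},\qquad \operatorname{Si}(x)=\int_0^x\frac{\sin\sigma}{\sigma}\,d\sigma .$$ **Theorem 3.1.** Assume that $f$ is analytic in $\psi(\mathscr{D}_d)$, and that there exist positive constants $K,\alpha,\beta$ such that $$|f(z)|\le K|E_1(z;\alpha)|\ \text{ for all } z\in\psi(\mathscr{D}_d^{-}),\qquad |f(z)|\le K|E_1(z;\beta)|\ \text{ for all } z\in\psi(\mathscr{D}_d^{+}).$$ Let $\mu=\min\{\alpha,\beta\}$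 and $\nu=\max\{\alpha,\beta\}$. Then $f$ is integrable on $\mathbb{R}$. Moreover, for every integer $n\ge 1$, if $$h=\sqrt{\frac{\pi d}{\mu n}},\qquad \begin{cases}M=n,\ N=\lceil\alpha n/\beta\rceil & \text{if }\mu=\alpha,\\ N=n,\ M=\lceil\beta n/\alpha\rceil & \text{if }\mu=\beta,\end{cases}$$ then $$\sup_{\tau\in\mathbb{R}}\left|\int_{-\infty}^{\tau}f(t)\,dt-\sum_{k=-M}^{N}f(\psi(kh))\,\psi'(kh)\,J(k,h)(\psi^{-1}(\tau))\right|\le C_1e^{-\sqrt{\pi d\mu n}},$$ where $C_1$ is the constant, independent of $n$, given by $$C_1=\frac{2^{\nu+1}K}{\mu}\left\{\frac{1}{(1-e^{-2\sqrt{\pi d\mu}})\{\cos d\}^{\nu}}\sqrt{\frac{\pi}{d\mu}}+1.1\right\}.$$ -/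

import Mathlib

open Real MeasureTheory

noncomputable section

namespace SincIndef

/-- The strip `{ζ : |Im ζ| < d}`. -/
def strip (d : ℝ) : Set ℂ := {ζ | |ζ.im| < d}

/-- The left half `{ζ ∈ strip d : Re ζ < 0}` of the strip. -/
def stripNeg (d : ℝ) : Set ℂ := {ζ | ζ ∈ strip d ∧ ζ.re < 0}

/-- The right half `{ζ ∈ strip d : Re ζ ≥ 0}` of the strip. -/
def stripPos (d : ℝ) : Set ℂ := {ζ | ζ ∈ strip d ∧ 0 ≤ ζ.re}

/-- `E₁(z; γ) = 1 / (1 + z²)^((γ + 1) / 2)`, with the principal power. -/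
def E1 (z : ℂ) (γ : ℝ) : ℂ := 1 / (1 + z ^ 2) ^ (((γ + 1) / 2 : ℝ) : ℂ)

/-- The sine integral `Si(x) = ∫₀ˣ sin σ / σ dσ`; `Real.sinc σ` is `sin σ / σ` for `σ ≠ 0`
and `1` for `σ = 0`. -/
def sineIntegral (x : ℝ) : ℝ := ∫ σ in (0 : ℝ)..x, Real.sinc σ

/-- The basis function `J(k,h)(x) = h {1/2 + (1/π) Si[π (x/h - k)]}`. -/
def J (k : ℤ) (h x : ℝ) : ℝ :=
  h * (1 / 2 + 1 / π * sineIntegral (π * (x / h - k)))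

/-- The mesh size `h = √(π d / (μ n))`. -/
def meshSize (d μ : ℝ) (n : ℕ) : ℝ := √(π * d / (μ * n))

/-- The lower truncation number: `M = n` if `μ = α`, and `M = ⌈β n / α⌉` if `μ = β`,
where `μ = min {α, β}` (both rules give `n` when `α = β`). -/
def lowerTrunc (α β : ℝ) (n : ℕ) : ℤ := if min α β = α then (n : ℤ) else ⌈β * n / α⌉

/-- The upper truncation number: `N = ⌈α n / β⌉` if `μ = α`, and `N = n` if `μ = β`,
where `μ = min {α, β}` (both rules give `n` when `α = β`). -/
def upperTrunc (α β : ℝ) (n : ℕ) : ℤ := if min α β = α then ⌈α * n / β⌉ else (n : ℤ)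

/-- The Sinc indefinite integration combined with the map `ψ = sinh`, whose derivative is `cosh`
and whose inverse is `arsinh`:
`∑_{k=-M}^{N} f(ψ(kh)) ψ'(kh) J(k,h)(ψ⁻¹(τ))`. -/
def sincIndefSum (f : ℂ → ℂ) (h : ℝ) (M N : ℤ) (τ : ℝ) : ℂ :=
  ∑ k ∈ Finset.Icc (-M) N,
    f ((Real.sinh (k * h) : ℝ) : ℂ) * ((Real.cosh (k * h) : ℝ) : ℂ) *
      ((J k h (Real.arsinh τ) : ℝ) : ℂ)

/-- The constant
`C₁ = (2^(ν+1) K / μ) { 1 / ((1 - exp(-2 √(π d μ))) (cos d)^ν) · √(π / (d μ)) + 1.1 }`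
with `μ = min {α, β}` and `ν = max {α, β}`. -/
def C1 (d K α β : ℝ) : ℝ :=
  (2 : ℝ) ^ (max α β + 1) * K / min α β *
    (1 / ((1 - Real.exp (-2 * √(π * d * min α β))) * Real.cos d ^ max α β) *
        √(π / (d * min α β))
      + 1.1)

end SincIndef

end

open Real MeasureTheory

namespace SincIndef

/-! Put F(ζ) = f(sinh ζ) cosh ζ (`pullback`). The substitution t = sinh x turns the integral of f up
to τ into that of F up to arsinh τ. Since 1 + sinh² = cosh² and |cosh ζ| ≥ e^{|Re ζ|} cos(Im ζ) / 2,
F is analytic in the strip and decays there like e^{α Re ζ} to the left and e^{-β Re ζ} to the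
right. The error is split at the full series ∑ F(kh) J(k,h).

Discretization (`norm_integral_Iic_sub_tsum_le`): Cauchy's formula on the lines Im ζ = ±δ and the
partial fractions of the cosecant write F(s) - ∑ F(kh) sinc(π(s/h - k)) as a contour integral of
F(ζ) sin(πs/h) / ((ζ - s) sin(πζ/h)). J(k,h) is the primitive of the sinc that vanishes at -∞, so
integrating in s gives the discretization error. The bound |sin(πζ/h)| ≥ sinh(πδ/h) produces the
exponential rate. The s-integral of sin(πs/h) / (ζ - s) is at most h/δ over every interval
(`norm_integral_sin_div_le`), which makes the estimate uniform in τ. Finally δ → d.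

Truncation (`TwoSidedExpDecay.norm_tsum_sub_sum_le`): |Si| ≤ 0.6π gives |J| ≤ 1.1h, and the tails of
F(kh) are geometric. Because αM ≥ μn, βN ≥ μn and πd/h = μnh = √(πdμn), both errors decay at the
same rate. -/

/-! ### Bounds for the sine integral -/

theorem integral_sin_mul_exp_neg (b y : ℝ) :
    ∫ x in (0 : ℝ)..b, sin x * exp (-(x * y)) =
      (1 + y ^ 2)⁻¹ - exp (-(b * y)) * (cos b + y * sin b) / (1 + y ^ 2) := by
  have hy : (1 + y ^ 2) ≠ 0 := by positivity
  have key : ∀ x ∈ Set.uIcc 0 b,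
      HasDerivAt (fun x : ℝ => -(exp (-(x * y)) * (cos x + y * sin x) / (1 + y ^ 2)))
        (sin x * exp (-(x * y))) x := by
    intro x _
    have h1 : HasDerivAt (fun x : ℝ => exp (-(x * y))) (exp (-(x * y)) * (-(1 * y))) x :=
      ((hasDerivAt_id x).mul_const y).neg.exp
    have h2 : HasDerivAt (fun x : ℝ => cos x + y * sin x) (-sin x + y * cos x) x :=
      (hasDerivAt_cos x).add ((hasDerivAt_sin x).const_mul y)
    refine HasDerivAt.congr_deriv (((h1.mul h2).div_const (1 + y ^ 2)).neg) ?_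
    field_simp
    ring
  rw [intervalIntegral.integral_eq_sub_of_hasDerivAt key
    (Continuous.intervalIntegrable (by fun_prop) _ _)]
  simp
  ring

theorem integral_exp_neg_mul_eq (b Y : ℝ) (hb : b ≠ 0) :
    ∫ y in (0 : ℝ)..Y, exp (-(b * y)) = (1 - exp (-(b * Y))) / b := by
  have key : ∀ y ∈ Set.uIcc 0 Y,
      HasDerivAt (fun y : ℝ => -(exp (-(b * y)) / b)) (exp (-(b * y))) y := by
    intro y _
    have h1 : HasDerivAt (fun y : ℝ => exp (-(b * y))) (exp (-(b * y)) * (-(b * 1))) y :=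
      ((hasDerivAt_id y).const_mul b).neg.exp
    refine HasDerivAt.congr_deriv ((h1.div_const b).neg) ?_
    field_simp
  rw [intervalIntegral.integral_eq_sub_of_hasDerivAt key
    (Continuous.intervalIntegrable (by fun_prop) _ _)]
  simp
  ring

theorem integral_exp_neg_mul_le (b Y : ℝ) (hb : 0 < b) :
    ∫ y in (0 : ℝ)..Y, exp (-(b * y)) ≤ 1 / b := by
  rw [integral_exp_neg_mul_eq b Y hb.ne']
  gcongr
  linarith [exp_pos (-(b * Y))]

theorem integral_sin_mul_exp_neg' (x Y : ℝ) :
    ∫ y in (0 : ℝ)..Y, sin x * exp (-(x * y)) = sinc x - sinc x * exp (-(Y * x)) := by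
  rw [intervalIntegral.integral_const_mul]
  rcases eq_or_ne x 0 with rfl | hx
  · simp
  · rw [integral_exp_neg_mul_eq x Y hx, sinc_of_ne_zero hx, mul_comm Y x]
    ring

/-- Fubini for sin x · e^{-xy} on [0, b] × [0, Y]: one order of integration produces Si(b), the
other arctan Y, each up to a damped integral. Letting Y → ∞ then compares Si(b) with π/2. -/
theorem abs_sineIntegral_sub_arctan_le (b Y : ℝ) (hb : 0 < b) (hY : 0 < Y) :
    |sineIntegral b - arctan Y| ≤ 1 / b + 1 / Y := by
  have swap : ∫ x in (0 : ℝ)..b, ∫ y in (0 : ℝ)..Y, sin x * exp (-(x * y)) =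
      ∫ y in (0 : ℝ)..Y, ∫ x in (0 : ℝ)..b, sin x * exp (-(x * y)) := by
    apply intervalIntegral_intervalIntegral_swap (F := fun x y => sin x * exp (-(x * y)))
    apply IntegrableOn.mono_set (t := Set.uIcc 0 b ×ˢ Set.uIcc 0 Y)
    · apply ContinuousOn.integrableOn_compact (isCompact_uIcc.prod isCompact_uIcc)
      apply Continuous.continuousOn
      unfold Function.uncurry
      fun_prop
    · exact Set.prod_mono Set.uIoc_subset_uIcc Set.uIoc_subset_uIcc
  simp_rw [integral_sin_mul_exp_neg, integral_sin_mul_exp_neg'] at swap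
  have c1 : Continuous fun x : ℝ => sinc x * exp (-(Y * x)) := by fun_prop
  have c2 : Continuous fun y : ℝ => exp (-(b * y)) * (cos b + y * sin b) / (1 + y ^ 2) :=
    Continuous.div (by fun_prop) (by fun_prop) (fun y => by positivity)
  have c3 : Continuous fun y : ℝ => (1 + y ^ 2)⁻¹ :=
    Continuous.inv₀ (by fun_prop) (fun y => by positivity)
  rw [intervalIntegral.integral_sub (continuous_sinc.intervalIntegrable _ _)
    (c1.intervalIntegrable _ _), intervalIntegral.integral_sub (c3.intervalIntegrable _ _)
    (c2.intervalIntegrable _ _), integral_inv_one_add_sq, arctan_zero, sub_zero] at swap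
  have e1 : |∫ x in (0 : ℝ)..b, sinc x * exp (-(Y * x))| ≤ 1 / Y := by
    refine le_trans ?_ (integral_exp_neg_mul_le Y b hY)
    rw [← Real.norm_eq_abs]
    refine intervalIntegral.norm_integral_le_of_norm_le hb.le
      (Filter.Eventually.of_forall fun x _ => ?_)
      (Continuous.intervalIntegrable (by fun_prop) _ _)
    rw [norm_mul, Real.norm_eq_abs, Real.norm_eq_abs, abs_exp]
    exact mul_le_of_le_one_left (exp_pos _).le (abs_sinc_le_one x)
  have e2 : |∫ y in (0 : ℝ)..Y, exp (-(b * y)) * (cos b + y * sin b) / (1 + y ^ 2)| ≤ 1 / b := by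
    refine le_trans ?_ (integral_exp_neg_mul_le b Y hb)
    rw [← Real.norm_eq_abs]
    refine intervalIntegral.norm_integral_le_of_norm_le hY.le
      (Filter.Eventually.of_forall fun y _ => ?_)
      (Continuous.intervalIntegrable (by fun_prop) _ _)
    rw [norm_div, norm_mul, Real.norm_eq_abs, Real.norm_eq_abs, Real.norm_eq_abs, abs_exp,
      abs_of_pos (by positivity : 0 < 1 + y ^ 2), mul_div_assoc]
    refine mul_le_of_le_one_right (exp_pos _).le ?_
    rw [div_le_one (by positivity)]
    apply abs_le_of_sq_le_sq _ (by positivity)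
    -- By Cauchy–Schwarz (cos b + y sin b)² ≤ 1 + y², which is at most (1 + y²)².
    nlinarith [sin_sq_add_cos_sq b, sq_nonneg (sin b - y * cos b), sq_nonneg y,
      sq_nonneg (y ^ 2)]
  have : sineIntegral b - arctan Y = (∫ x in (0 : ℝ)..b, sinc x * exp (-(Y * x))) -
      ∫ y in (0 : ℝ)..Y, exp (-(b * y)) * (cos b + y * sin b) / (1 + y ^ 2) := by
    unfold sineIntegral
    linarith
  rw [this]
  exact (abs_sub _ _).trans (by linarith)

theorem abs_sineIntegral_sub_pi_div_two_le (b : ℝ) (hb : 0 < b) :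
    |sineIntegral b - π / 2| ≤ 1 / b := by
  have h1 : Filter.Tendsto (fun Y : ℝ => |sineIntegral b - arctan Y|) Filter.atTop
      (nhds |sineIntegral b - π / 2|) :=
    ((tendsto_arctan_atTop.mono_right nhdsWithin_le_nhds).const_sub _).abs
  have h2 : Filter.Tendsto (fun Y : ℝ => 1 / b + 1 / Y) Filter.atTop (nhds (1 / b + 0)) :=
    Filter.Tendsto.const_add _ (tendsto_inv_atTop_zero.congr fun Y => (one_div Y).symm)
  rw [add_zero] at h2
  refine le_of_tendsto_of_tendsto h1 h2 ?_
  filter_upwards [Filter.eventually_gt_atTop 0] with Y hY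
  exact abs_sineIntegral_sub_arctan_le b Y hb hY

theorem sineIntegral_neg (b : ℝ) : sineIntegral (-b) = -sineIntegral b := by
  unfold sineIntegral
  have := intervalIntegral.integral_comp_neg (a := 0) (b := b) (fun x => sinc x)
  simp only [sinc_neg, neg_zero] at this
  rw [this, intervalIntegral.integral_symm]

theorem hasDerivAt_sineIntegral (x : ℝ) : HasDerivAt sineIntegral (sinc x) x :=
  (continuous_sinc.integral_hasStrictDerivAt 0 x).hasDerivAt

/-- A function vanishing at the origin with nonnegative derivative on the positive axis is
nonnegative there. -/
theorem nonneg_of_hasDerivAt_nonneg {g g' : ℝ → ℝ} (h0 : g 0 = 0)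
    (hd : ∀ x, HasDerivAt g (g' x) x) (hg : ∀ x, 0 ≤ x → 0 ≤ g' x) :
    ∀ x, 0 ≤ x → 0 ≤ g x := by
  intro x hx
  have : MonotoneOn g (Set.Ici 0) := by
    apply monotoneOn_of_hasDerivWithinAt_nonneg (f' := g') (convex_Ici 0)
      (fun y _ => (hd y).continuousAt.continuousWithinAt)
      (fun y _ => (hd y).hasDerivWithinAt)
    intro y hy
    rw [interior_Ici] at hy
    exact hg y (le_of_lt hy)
  rw [← h0]
  exact this Set.self_mem_Ici hx hx

/-- Repeated integration of sin x ≤ x from the origin: each `s` statement is the derivative of the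
next. -/
theorem sin_le_taylor_nine (x : ℝ) (hx : 0 ≤ x) :
    0 ≤ x - x ^ 3 / 6 + x ^ 5 / 120 - x ^ 7 / 5040 + x ^ 9 / 362880 - sin x := by
  have d : ∀ (n : ℕ) (c x : ℝ), HasDerivAt (fun x : ℝ => x ^ n / c) (n * x ^ (n - 1) / c) x :=
    fun n c x => (hasDerivAt_pow n x).div_const c
  have s1 : ∀ x : ℝ, 0 ≤ x → 0 ≤ x - sin x := fun x hx => by linarith [sin_le hx]
  have s2 : ∀ x : ℝ, 0 ≤ x → 0 ≤ x ^ 2 / 2 + cos x - 1 := by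
    apply nonneg_of_hasDerivAt_nonneg (by simp) (fun x => ?_) s1
    refine HasDerivAt.congr_deriv (((d 2 2 x).add (hasDerivAt_cos x)).sub_const 1) ?_
    simp; ring
  have s3 : ∀ x : ℝ, 0 ≤ x → 0 ≤ x ^ 3 / 6 + sin x - x := by
    apply nonneg_of_hasDerivAt_nonneg (by simp) (fun x => ?_) s2
    refine HasDerivAt.congr_deriv (((d 3 6 x).add (hasDerivAt_sin x)).sub (hasDerivAt_id x)) ?_
    simp; ring
  have s4 : ∀ x : ℝ, 0 ≤ x → 0 ≤ x ^ 4 / 24 - cos x - x ^ 2 / 2 + 1 := by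
    apply nonneg_of_hasDerivAt_nonneg (by simp) (fun x => ?_) s3
    refine HasDerivAt.congr_deriv ((((d 4 24 x).sub (hasDerivAt_cos x)).sub (d 2 2 x)).add_const 1) ?_
    simp; ring
  have s5 : ∀ x : ℝ, 0 ≤ x → 0 ≤ x ^ 5 / 120 - sin x - x ^ 3 / 6 + x := by
    apply nonneg_of_hasDerivAt_nonneg (by simp) (fun x => ?_) s4
    refine HasDerivAt.congr_deriv ((((d 5 120 x).sub (hasDerivAt_sin x)).sub (d 3 6 x)).add (hasDerivAt_id x)) ?_
    simp; ring
  have s6 : ∀ x : ℝ, 0 ≤ x → 0 ≤ x ^ 6 / 720 + cos x - x ^ 4 / 24 + x ^ 2 / 2 - 1 := by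
    apply nonneg_of_hasDerivAt_nonneg (by simp) (fun x => ?_) s5
    refine HasDerivAt.congr_deriv (((((d 6 720 x).add (hasDerivAt_cos x)).sub (d 4 24 x)).add (d 2 2 x)).sub_const 1) ?_
    simp; ring
  have s7 : ∀ x : ℝ, 0 ≤ x → 0 ≤ x ^ 7 / 5040 + sin x - x ^ 5 / 120 + x ^ 3 / 6 - x := by
    apply nonneg_of_hasDerivAt_nonneg (by simp) (fun x => ?_) s6
    refine HasDerivAt.congr_deriv (((((d 7 5040 x).add (hasDerivAt_sin x)).sub (d 5 120 x)).add (d 3 6 x)).sub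
      (hasDerivAt_id x)) ?_
    simp; ring
  have s8 : ∀ x : ℝ, 0 ≤ x →
      0 ≤ x ^ 8 / 40320 - cos x - x ^ 6 / 720 + x ^ 4 / 24 - x ^ 2 / 2 + 1 := by
    apply nonneg_of_hasDerivAt_nonneg (by simp) (fun x => ?_) s7
    refine HasDerivAt.congr_deriv ((((((d 8 40320 x).sub (hasDerivAt_cos x)).sub (d 6 720 x)).add (d 4 24 x)).sub
      (d 2 2 x)).add_const 1) ?_
    simp; ring
  have s9 : ∀ x : ℝ, 0 ≤ x →
      0 ≤ x ^ 9 / 362880 - sin x - x ^ 7 / 5040 + x ^ 5 / 120 - x ^ 3 / 6 + x := by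
    apply nonneg_of_hasDerivAt_nonneg (by simp) (fun x => ?_) s8
    refine HasDerivAt.congr_deriv ((((((d 9 362880 x).sub (hasDerivAt_sin x)).sub (d 7 5040 x)).add (d 5 120 x)).sub
      (d 3 6 x)).add (hasDerivAt_id x)) ?_
    simp; ring
  linarith [s9 x hx]

theorem sineIntegral_le_taylor_nine (x : ℝ) (hx : 0 ≤ x) :
    sineIntegral x ≤ x - x ^ 3 / 18 + x ^ 5 / 600 - x ^ 7 / 35280 + x ^ 9 / 3265920 := by
  have d : ∀ (n : ℕ) (c x : ℝ), HasDerivAt (fun x : ℝ => x ^ n / c) (n * x ^ (n - 1) / c) x :=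
    fun n c x => (hasDerivAt_pow n x).div_const c
  have key : ∀ x : ℝ, 0 ≤ x →
      0 ≤ x - x ^ 3 / 18 + x ^ 5 / 600 - x ^ 7 / 35280 + x ^ 9 / 3265920 - sineIntegral x := by
    apply nonneg_of_hasDerivAt_nonneg
      (g' := fun x => 1 - x ^ 2 / 6 + x ^ 4 / 120 - x ^ 6 / 5040 + x ^ 8 / 362880 - sinc x)
      (by simp [sineIntegral]) (fun x => ?_) (fun x hx => ?_)
    · refine HasDerivAt.congr_deriv ((((((hasDerivAt_id x).sub (d 3 18 x)).add (d 5 600 x)).sub (d 7 35280 x)).add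
        (d 9 3265920 x)).sub (hasDerivAt_sineIntegral x)) ?_
      simp; ring
    · rcases hx.eq_or_lt with rfl | hx'
      · simp
      · have := sin_le_taylor_nine x hx
        rw [sinc_of_ne_zero hx'.ne']
        have e : 1 - x ^ 2 / 6 + x ^ 4 / 120 - x ^ 6 / 5040 + x ^ 8 / 362880 - sin x / x =
          (x - x ^ 3 / 6 + x ^ 5 / 120 - x ^ 7 / 5040 + x ^ 9 / 362880 - sin x) / x := by
          field_simp
        rw [e]
        positivity
  linarith [key x hx]

/-- The upper Taylor bounds have degrees 1, 5, 9, ...; degree 5 gives about 0.614π, so degree 9 is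
the first that suffices. -/
theorem sineIntegral_pi_le : sineIntegral π ≤ 0.6 * π := by
  have h := sineIntegral_le_taylor_nine π pi_pos.le
  have h1 := pi_gt_d4
  have h2 := pi_lt_d4
  have a2 : π ^ 2 ≤ 9.8697 := by nlinarith
  have b2 : 9.869 ≤ π ^ 2 := by nlinarith
  have a4 : π ^ 4 ≤ 97.411 := by nlinarith
  have b4 : 97.39 ≤ π ^ 4 := by nlinarith
  have b6 : 961 ≤ π ^ 6 := by nlinarith
  have a8 : π ^ 8 ≤ 9489 := by nlinarith
  have : π - π ^ 3 / 18 + π ^ 5 / 600 - π ^ 7 / 35280 + π ^ 9 / 3265920 =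
    π * (1 - π ^ 2 / 18 + π ^ 4 / 600 - π ^ 6 / 35280 + π ^ 8 / 3265920) := by ring
  rw [this] at h
  refine h.trans ?_
  rw [mul_comm 0.6 π]
  gcongr
  linarith

/-- The integrand is nonnegative on [0, π] and nonpositive on [π, 2π], so Si is largest at π on [0,
2π]. Beyond 2π the bound π/2 + 1/x ≤ π/2 + 1/6 is already small enough. -/
theorem sineIntegral_le_of_nonneg (x : ℝ) (hx : 0 ≤ x) : sineIntegral x ≤ 0.6 * π := by
  have hint : ∀ a b : ℝ, IntervalIntegrable sinc volume a b :=
    fun a b => continuous_sinc.intervalIntegrable a b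
  have hsub : sineIntegral x + ∫ s in x..π, sinc s = sineIntegral π :=
    intervalIntegral.integral_add_adjacent_intervals (hint _ _) (hint _ _)
  rcases le_total x π with h | h
  · have : 0 ≤ ∫ s in x..π, sinc s := by
      apply intervalIntegral.integral_nonneg h
      intro s hs
      rcases (hx.trans hs.1).eq_or_lt with rfl | hs'
      · simp
      · rw [sinc_of_ne_zero hs'.ne']
        exact div_nonneg (sin_nonneg_of_nonneg_of_le_pi hs'.le hs.2) hs'.le
    linarith [sineIntegral_pi_le]
  rcases le_total x (2 * π) with h' | h'
  · have : 0 ≤ ∫ s in π..x, -sinc s := by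
      apply intervalIntegral.integral_nonneg h
      intro s hs
      have hs' : 0 < s := pi_pos.trans_le hs.1
      rw [sinc_of_ne_zero hs'.ne', ← neg_div, ← sin_sub_pi]
      exact div_nonneg (sin_nonneg_of_nonneg_of_le_pi (by linarith [hs.1])
        (by linarith [hs.2])) hs'.le
    rw [intervalIntegral.integral_neg, ← intervalIntegral.integral_symm] at this
    linarith [sineIntegral_pi_le]
  · have hp := pi_gt_three
    have := (abs_le.1 (abs_sineIntegral_sub_pi_div_two_le x (by linarith))).2
    have h6 : 1 / x ≤ 1 / 6 := by gcongr; linarith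
    linarith

theorem sineIntegral_nonneg (x : ℝ) (hx : 0 ≤ x) : 0 ≤ sineIntegral x := by
  rcases le_total x 1 with h | h
  · apply intervalIntegral.integral_nonneg hx
    intro s hs
    rcases hs.1.eq_or_lt with rfl | hs'
    · simp
    · rw [sinc_of_ne_zero hs'.ne']
      exact div_nonneg (sin_nonneg_of_nonneg_of_le_pi hs'.le (by linarith [hs.2, pi_gt_three]))
        hs'.le
  · have := (abs_le.1 (abs_sineIntegral_sub_pi_div_two_le x (by linarith))).1
    have h6 : 1 / x ≤ 1 := by rw [div_le_one (by linarith)]; exact h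
    linarith [pi_gt_three]

theorem abs_half_add_sineIntegral_le (x : ℝ) : |1 / 2 + 1 / π * sineIntegral x| ≤ 1.1 := by
  have key : |sineIntegral x| ≤ 0.6 * π := by
    rcases le_total 0 x with h | h
    · rw [abs_of_nonneg (sineIntegral_nonneg x h)]
      exact sineIntegral_le_of_nonneg x h
    · rw [← abs_neg, ← sineIntegral_neg,
        abs_of_nonneg (sineIntegral_nonneg (-x) (by linarith))]
      exact sineIntegral_le_of_nonneg (-x) (by linarith)
  have h2 : |1 / π * sineIntegral x| ≤ 0.6 := by
    rw [abs_mul, abs_of_pos (by positivity : 0 < 1 / π), one_div, inv_mul_le_iff₀ pi_pos]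
    linarith
  rw [abs_le] at h2 ⊢
  constructor <;> linarith

/-! ### The basis functions as primitives of shifted sincs -/

theorem abs_J_le (k : ℤ) (h x : ℝ) (hh : 0 < h) : |J k h x| ≤ 1.1 * h := by
  unfold J
  rw [abs_mul, abs_of_pos hh, mul_comm]
  gcongr
  exact abs_half_add_sineIntegral_le _

theorem tendsto_J_atBot (k : ℤ) (h : ℝ) (hh : 0 < h) :
    Filter.Tendsto (J k h) Filter.atBot (nhds 0) := by
  have h1 : Filter.Tendsto sineIntegral Filter.atTop (nhds (π / 2)) := by
    rw [tendsto_iff_norm_sub_tendsto_zero]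
    refine squeeze_zero' (Filter.Eventually.of_forall fun _ => norm_nonneg _) ?_
      (tendsto_inv_atTop_zero (𝕜 := ℝ))
    filter_upwards [Filter.eventually_gt_atTop 0] with x hx
    simpa using abs_sineIntegral_sub_pi_div_two_le x hx
  have h2 : Filter.Tendsto sineIntegral Filter.atBot (nhds (-(π / 2))) := by
    have := (h1.comp Filter.tendsto_neg_atBot_atTop).neg
    refine this.congr fun x => ?_
    simp [sineIntegral_neg]
  have h3 : Filter.Tendsto (fun x : ℝ => π * (x / h - k)) Filter.atBot Filter.atBot := by
    apply Filter.Tendsto.const_mul_atBot pi_pos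
    apply Filter.tendsto_atBot_add_const_right
    exact Filter.tendsto_id.atBot_div_const hh
  have h4 := (((h2.comp h3).const_mul (1 / π)).const_add (1 / 2)).const_mul h
  have e : h * (1 / 2 + 1 / π * -(π / 2)) = 0 := by
    field_simp
    ring
  rwa [e] at h4

theorem hasDerivAt_J (k : ℤ) (h x : ℝ) (hh : 0 < h) :
    HasDerivAt (J k h) (sinc (π * (x / h - k))) x := by
  have h1 : HasDerivAt (fun x : ℝ => π * (x / h - k)) (π * (1 / h)) x :=
    (((hasDerivAt_id x).div_const h).sub_const _).const_mul π
  have h2 := (hasDerivAt_sineIntegral (π * (x / h - k))).comp x h1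
  refine HasDerivAt.congr_deriv (((h2.const_mul (1 / π)).const_add (1 / 2)).const_mul h) ?_
  field_simp

theorem integral_sinc_eq_J_sub (k : ℤ) (h a b : ℝ) (hh : 0 < h) :
    ∫ s in a..b, sinc (π * (s / h - k)) = J k h b - J k h a :=
  intervalIntegral.integral_eq_sub_of_hasDerivAt (fun x _ => hasDerivAt_J k h x hh)
    (Continuous.intervalIntegrable (by fun_prop) _ _)

/-! ### Partial fractions of the cotangent and cosecant -/

theorem sub_intCast_ne_zero {z : ℂ} (hz : z ∈ Complex.integerComplement) (k : ℤ) :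
    z - k ≠ 0 := fun h => hz ⟨k, (sub_eq_zero.1 h).symm⟩

/-- The series ∑ 1/(x - k) over ℤ does not converge absolutely, but differences at two points are
O(k⁻²). Pairing k with -k then reduces to the cotangent series. -/
theorem hasSum_inv_sub_inv {x y : ℂ} (hx : x ∈ Complex.integerComplement)
    (hy : y ∈ Complex.integerComplement) :
    HasSum (fun k : ℤ => 1 / (x - k) - 1 / (y - k))
      (π * Complex.cot (π * x) - π * Complex.cot (π * y)) := by
  have hsum : Summable (fun k : ℤ => 1 / (x - k) - 1 / (y - k)) := by
    have h1 : Summable fun k : ℤ => (y - x) * ((-x + k) * (-y + k) : ℂ)⁻¹ := by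
      apply Summable.mul_left
      apply EisensteinSeries.summable_inv_of_isBigO_rpow_inv (a := 2) (by norm_num)
      have := (EisensteinSeries.linear_inv_isBigO_right 1 (-x)).mul
        (EisensteinSeries.linear_inv_isBigO_right 1 (-y))
      simpa [pow_two, mul_comm] using this
    refine h1.congr fun k => ?_
    have a := sub_intCast_ne_zero hx k
    have b := sub_intCast_ne_zero hy k
    have a' : -x + k ≠ 0 := by intro h; apply a; linear_combination -h
    have b' : -y + k ≠ 0 := by intro h; apply b; linear_combination -h
    field_simp
    ring
  have e := tsum_of_add_one_of_neg_add_one (f := fun k : ℤ => 1 / (x - k) - 1 / (y - k))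
    (hsum.comp_injective (i := fun n : ℕ => (n : ℤ) + 1) (fun a b h => by simpa using h))
    (hsum.comp_injective (i := fun n : ℕ => -((n : ℤ) + 1)) (fun a b h => by simpa using h))
  have s1 := summable_cotTerm hx
  have s2 := summable_cotTerm hy
  unfold cotTerm at s1 s2
  have : ∑' k : ℤ, (1 / (x - k) - 1 / (y - k)) =
      π * Complex.cot (π * x) - π * Complex.cot (π * y) := by
    rw [e, add_right_comm, ← Summable.tsum_add]
    · have c1 := cot_series_rep' hx
      have c2 := cot_series_rep' hy
      have c3 := s1.tsum_sub s2
      rw [← c1, ← c2] at c3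
      have : ∀ n : ℕ, (1 / (x - ((n : ℤ) + 1 : ℤ)) - 1 / (y - ((n : ℤ) + 1 : ℤ))) +
          (1 / (x - (-((n : ℤ) + 1) : ℤ)) - 1 / (y - (-((n : ℤ) + 1) : ℤ))) =
          1 / (x - (n + 1)) + 1 / (x + (n + 1)) - (1 / (y - (n + 1)) + 1 / (y + (n + 1))) := by
        intro n
        push_cast
        simp only [sub_neg_eq_add]
        ring
      simp_rw [this]
      rw [c3]
      simp only [Int.cast_zero, sub_zero]
      ring
    · exact hsum.comp_injective (i := fun n : ℕ => (n : ℤ) + 1) (fun a b h => by simpa using h)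
    · exact hsum.comp_injective (i := fun n : ℕ => -((n : ℤ) + 1))
        (fun a b h => by simpa using h)
  rw [← this]
  exact hsum.hasSum

theorem cot_half_sub_cot (w : ℂ) (hw : Complex.sin w ≠ 0) :
    Complex.cot (w / 2) - Complex.cot w = 1 / Complex.sin w := by
  have e : Complex.sin w = 2 * Complex.sin (w / 2) * Complex.cos (w / 2) := by
    rw [← Complex.sin_two_mul]; congr 1; ring
  have e' : Complex.cos w = 2 * Complex.cos (w / 2) ^ 2 - 1 := by
    rw [← Complex.cos_two_mul]; congr 1; ring
  have h1 : Complex.sin (w / 2) ≠ 0 := by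
    intro h; apply hw; rw [e, h]; ring
  have h2 : Complex.cos (w / 2) ≠ 0 := by
    intro h; apply hw; rw [e, h]; ring
  rw [Complex.cot, Complex.cot, e, e']
  field_simp
  ring

theorem half_mem_integerComplement {x : ℂ} (hx : x ∈ Complex.integerComplement) :
    x / 2 ∈ Complex.integerComplement := by
  rintro ⟨k, hk⟩
  exact hx ⟨2 * k, by push_cast; rw [hk]; ring⟩

/-- The difference form of the partial fraction expansion of the cosecant. -/
theorem hasSum_neg_one_zpow_mul_inv_sub_inv {x y : ℂ} (hx : x ∈ Complex.integerComplement)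
    (hy : y ∈ Complex.integerComplement) :
    HasSum (fun k : ℤ => (-1 : ℂ) ^ k * (1 / (x - k) - 1 / (y - k)))
      (π / Complex.sin (π * x) - π / Complex.sin (π * y)) := by
  have h1 := hasSum_inv_sub_inv hx hy
  have h2 := hasSum_inv_sub_inv (half_mem_integerComplement hx) (half_mem_integerComplement hy)
  have inj : Function.Injective fun k : ℤ => 2 * k := fun a b h => by simpa using h
  -- The factor 1 + (-1)^k kills odd k, and 2/(x - 2m) = 1/(x/2 - m), so this is the cotangent
  -- series at x/2 and y/2. Subtracting `h1` leaves the alternating series.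
  have h3 : HasSum (fun k : ℤ => (1 + (-1 : ℂ) ^ k) * (1 / (x - k) - 1 / (y - k)))
      (π * Complex.cot (π * (x / 2)) - π * Complex.cot (π * (y / 2))) := by
    rw [← inj.hasSum_iff]
    · refine h2.congr_fun fun k => ?_
      have a := sub_intCast_ne_zero hx (2 * k)
      have b := sub_intCast_ne_zero hy (2 * k)
      have e1 : x / 2 - k = (x - (2 * k : ℤ)) / 2 := by push_cast; ring
      have e2 : y / 2 - k = (y - (2 * k : ℤ)) / 2 := by push_cast; ring
      simp only [Function.comp_apply, zpow_mul]
      rw [e1, e2]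
      norm_num
      ring
    · intro k hk
      have : Odd k := by
        rw [← Int.not_even_iff_odd]
        rintro ⟨m, hm⟩
        exact hk ⟨m, by simp only [hm]; ring⟩
      rw [this.neg_one_zpow]
      ring
  have h4 := h3.sub h1
  have sx := sin_pi_mul_ne_zero hx
  have sy := sin_pi_mul_ne_zero hy
  have tx := cot_half_sub_cot _ sx
  have ty := cot_half_sub_cot _ sy
  have e : π / Complex.sin (π * x) - π / Complex.sin (π * y) =
      π * Complex.cot (π * (x / 2)) - π * Complex.cot (π * (y / 2)) -
        (π * Complex.cot (π * x) - π * Complex.cot (π * y)) := by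
    rw [← mul_div_assoc, ← mul_div_assoc]
    linear_combination (-π : ℂ) * tx + (π : ℂ) * ty
  rw [e]
  exact h4.congr_fun fun k => by ring

/-- Here sinc(π(s/h - k)) = (-1)^k sin(πs/h) / (π(s/h - k)). Splitting 1/((s - kh)(ζ - kh)) into
partial fractions gives the cosecant expansion at s/h and ζ/h; s avoids the nodes so that s/h is not
an integer. -/
theorem hasSum_sinc_div (h : ℝ) (hh : 0 < h) (s : ℝ) (hs : ∀ k : ℤ, s ≠ k * h) (ζ : ℂ)
    (hζ : ζ.im ≠ 0) :
    HasSum (fun k : ℤ => (sinc (π * (s / h - k)) : ℂ) / (ζ - k * h))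
      (1 / (ζ - s) - Complex.sin (π * (s / h)) / ((ζ - s) * Complex.sin (π * (ζ / h)))) := by
  have hh' : (h : ℂ) ≠ 0 := by exact_mod_cast hh.ne'
  have hx : ((s / h : ℝ) : ℂ) ∈ Complex.integerComplement := by
    rintro ⟨k, hk⟩
    apply hs k
    have : (k : ℝ) = s / h := by exact_mod_cast hk
    rw [this]; field_simp
  have hy : ζ / h ∈ Complex.integerComplement := by
    rintro ⟨k, hk⟩
    apply hζ
    have : ζ = ((k * h : ℝ) : ℂ) := by push_cast; rw [hk]; field_simp
    rw [this, Complex.ofReal_im]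
  have hne : ζ - s ≠ 0 := by
    intro h0
    apply hζ
    rw [sub_eq_zero.1 h0, Complex.ofReal_im]
  have sx := sin_pi_mul_ne_zero hx
  have sy := sin_pi_mul_ne_zero hy
  have key := (hasSum_neg_one_zpow_mul_inv_sub_inv hx hy).mul_left
    (Complex.sin (π * (s / h : ℝ)) / (π * (ζ - s)))
  have hp : (π : ℂ) ≠ 0 := by exact_mod_cast pi_ne_zero
  have e : 1 / (ζ - s) - Complex.sin (π * (s / h)) / ((ζ - s) * Complex.sin (π * (ζ / h))) =
      Complex.sin (π * (s / h : ℝ)) / (π * (ζ - s)) *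
        (π / Complex.sin (π * (s / h : ℝ)) - π / Complex.sin (π * (ζ / h))) := by
    generalize Complex.sin (π * (ζ / h)) = w at sy ⊢
    push_cast at sx ⊢
    generalize Complex.sin (π * (s / h)) = v at sx ⊢
    field_simp
  rw [e]
  refine key.congr_fun fun k => ?_
  have a := sub_intCast_ne_zero hx k
  have b := sub_intCast_ne_zero hy k
  have ar : s / h - k ≠ 0 := by intro h0; apply a; exact_mod_cast h0
  have c : ζ - k * h ≠ 0 := by
    intro h0; apply b; field_simp; linear_combination h0
  rw [sinc_of_ne_zero (mul_ne_zero pi_ne_zero ar),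
    show π * (s / h - k) = π * (s / h) - k * π by ring, sin_sub_int_mul_pi]
  push_cast at a sx ⊢
  have a2 : (s : ℂ) - k * h ≠ 0 := by
    intro h0; apply a; field_simp; linear_combination h0
  have e1 : (s : ℂ) / h - k = (s - k * h) / h := by field_simp
  have e2 : ζ / h - k = (ζ - k * h) / h := by field_simp
  have e3 : (π : ℂ) * (s / h) - k * π = π * (s - k * h) / h := by field_simp
  have e4 : ζ - s = (ζ - k * h) - (s - k * h) := by ring
  rw [e4] at hne
  rw [e1, e2, e3, e4]
  generalize ζ - k * h = v at *
  generalize (s : ℂ) - k * h = u at *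
  generalize Complex.sin (π * (s / h)) = t at *
  field_simp

/-! ### Cauchy's formula on a strip -/

/-- As T → ∞ the right side tends to 2πi, the residue term of Cauchy's formula. -/
theorem integral_inv_sub_inv_conj (δ T : ℝ) (hδ : 0 < δ) :
    (∫ x in (-T)..T, 1 / ((x : ℂ) - δ * Complex.I)) -
      ∫ x in (-T)..T, 1 / ((x : ℂ) + δ * Complex.I) =
      4 * Complex.I * (arctan (T / δ) : ℝ) := by
  have ne1 : ∀ x : ℝ, (x : ℂ) - δ * Complex.I ≠ 0 := fun x h0 => by
    have := congrArg Complex.im h0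
    simp at this
    exact hδ.ne' this
  have ne2 : ∀ x : ℝ, (x : ℂ) + δ * Complex.I ≠ 0 := fun x h0 => by
    have := congrArg Complex.im h0
    simp at this
    exact hδ.ne' this
  rw [← intervalIntegral.integral_sub]
  rotate_left
  · exact Continuous.intervalIntegrable (Continuous.div (by fun_prop) (by fun_prop) ne1) _ _
  · exact Continuous.intervalIntegrable (Continuous.div (by fun_prop) (by fun_prop) ne2) _ _
  have key : ∀ x : ℝ, 1 / ((x : ℂ) - δ * Complex.I) - 1 / ((x : ℂ) + δ * Complex.I) =
      ((2 * (1 / (1 + (x / δ) ^ 2) * (1 / δ)) : ℝ) : ℂ) * Complex.I := by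
    intro x
    have p : (1 + (x / δ) ^ 2 : ℝ) ≠ 0 := by positivity
    have p2 : (1 + (x / δ) ^ 2 : ℂ) ≠ 0 := by exact_mod_cast p
    have a := ne1 x
    have b := ne2 x
    have c : (δ : ℂ) ≠ 0 := by exact_mod_cast hδ.ne'
    have e : ((x : ℂ) - δ * Complex.I) * ((x : ℂ) + δ * Complex.I) =
        δ ^ 2 * (1 + (x / δ) ^ 2) := by
      field_simp
      linear_combination (-(δ : ℂ) ^ 2) * Complex.I_sq
    rw [div_sub_div _ _ a b, e]
    push_cast
    field_simp
    ring
  simp_rw [key]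
  rw [intervalIntegral.integral_mul_const, intervalIntegral.integral_ofReal]
  have hd : ∀ x ∈ Set.uIcc (-T) T, HasDerivAt (fun x : ℝ => 2 * arctan (x / δ))
      (2 * (1 / (1 + (x / δ) ^ 2) * (1 / δ))) x := fun x _ =>
    (((hasDerivAt_id x).div_const δ).arctan).const_mul 2
  rw [intervalIntegral.integral_eq_sub_of_hasDerivAt hd]
  · rw [neg_div, arctan_neg]
    push_cast
    ring
  · apply Continuous.intervalIntegrable
    refine Continuous.mul continuous_const (Continuous.mul (Continuous.div (by fun_prop)
      (by fun_prop) fun x => by positivity) (by fun_prop))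

theorem le_norm_strip_line_sub (x t δ : ℝ) (hδ : 0 < δ) :
    δ ≤ ‖(x : ℂ) - δ * Complex.I - t‖ ∧ δ ≤ ‖(x : ℂ) + δ * Complex.I - t‖ := by
  constructor
  · refine le_trans ?_ (Complex.abs_im_le_norm _)
    simp [abs_of_pos hδ]
  · refine le_trans ?_ (Complex.abs_im_le_norm _)
    simp [abs_of_pos hδ]

/-- Cauchy's integral formula at the origin for the strip `|Im ζ| ≤ δ`. -/
theorem cauchy_formula_strip_zero {F : ℂ → ℂ} {d δ C : ℝ} (hδ : 0 < δ) (hδd : δ < d)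
    (hF : DifferentiableOn ℂ F (strip d)) (hC : ∀ z : ℂ, |z.im| ≤ δ → ‖F z‖ ≤ C)
    (h1 : Integrable fun x : ℝ => F (x - δ * Complex.I))
    (h2 : Integrable fun x : ℝ => F (x + δ * Complex.I)) :
    (∫ x : ℝ, F (x - δ * Complex.I) / (x - δ * Complex.I)) -
      ∫ x : ℝ, F (x + δ * Complex.I) / (x + δ * Complex.I) = 2 * π * Complex.I * F 0 := by
  have hopen : IsOpen (strip d) := isOpen_lt (by fun_prop) continuous_const
  have h0 : (0 : ℂ) ∈ strip d := by simp [strip]; linarith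
  -- The slope (F(z) - F(0))/z extends analytically across 0, so its integral over a rectangle
  -- vanishes. The subtracted F(0)/z is integrated explicitly on the horizontal sides.
  have hG : DifferentiableOn ℂ (dslope F 0) (strip d) :=
    (Complex.differentiableOn_dslope (hopen.mem_nhds h0)).2 hF
  have ne1 : ∀ x : ℝ, (x : ℂ) - δ * Complex.I ≠ 0 := fun x h0 => by
    have := congrArg Complex.im h0
    simp at this
    exact hδ.ne' this
  have ne2 : ∀ x : ℝ, (x : ℂ) + δ * Complex.I ≠ 0 := fun x h0 => by
    have := congrArg Complex.im h0
    simp at this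
    exact hδ.ne' this
  have c1 : Continuous fun x : ℝ => F (x - δ * Complex.I) :=
    hF.continuousOn.comp_continuous (by fun_prop) fun x => by
      simp [strip, abs_of_pos hδ, hδd]
  have c2 : Continuous fun x : ℝ => F (x + δ * Complex.I) :=
    hF.continuousOn.comp_continuous (by fun_prop) fun x => by
      simp [strip, abs_of_pos hδ, hδd]
  have d1 : Continuous fun x : ℝ => 1 / ((x : ℂ) - δ * Complex.I) :=
    Continuous.div (by fun_prop) (by fun_prop) ne1
  have d2 : Continuous fun x : ℝ => 1 / ((x : ℂ) + δ * Complex.I) :=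
    Continuous.div (by fun_prop) (by fun_prop) ne2
  have q1 : Continuous fun x : ℝ => F (x - δ * Complex.I) / (x - δ * Complex.I) :=
    Continuous.div c1 (by fun_prop) ne1
  have q2 : Continuous fun x : ℝ => F (x + δ * Complex.I) / (x + δ * Complex.I) :=
    Continuous.div c2 (by fun_prop) ne2
  have C0 : 0 ≤ C := (norm_nonneg _).trans (hC 0 (by simpa using hδ.le))
  -- the contribution of the vertical sides
  have vert : ∀ T : ℝ, 0 < T → ∀ σ : ℝ, |σ| = T →
      ‖∫ y in (-δ)..δ, dslope F 0 (σ + y * Complex.I)‖ ≤ 2 * C / T * (2 * δ) := by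
    intro T hT σ hσ
    have := intervalIntegral.norm_integral_le_of_norm_le_const (a := -δ) (b := δ)
      (f := fun y : ℝ => dslope F 0 (σ + y * Complex.I)) (C := 2 * C / T) fun y hy => by
        rw [Set.uIoc_of_le (by linarith)] at hy
        have hne : (σ + y * Complex.I : ℂ) ≠ 0 := by
          intro h
          have := congrArg Complex.re h
          simp at this
          rw [this] at hσ
          simp at hσ
          linarith
        rw [dslope_of_ne _ hne, slope_def_field, sub_zero, norm_div]
        have n1 : T ≤ ‖(σ + y * Complex.I : ℂ)‖ := by
          refine le_trans ?_ (Complex.abs_re_le_norm _)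
          simp [hσ]
        have n2 : ‖F (σ + y * Complex.I) - F 0‖ ≤ 2 * C := by
          refine (norm_sub_le _ _).trans ?_
          have a := hC (σ + y * Complex.I) (by simpa using abs_le.2 ⟨hy.1.le, hy.2⟩)
          have b := hC 0 (by simpa using hδ.le)
          linarith
        exact div_le_div₀ (by positivity) n2 hT n1
    rwa [show |δ - -δ| = 2 * δ by rw [abs_of_pos (by linarith)]; ring] at this
  have rect : ∀ T : ℝ, 0 < T →
      (∫ x in (-T)..T, F (x - δ * Complex.I) / (x - δ * Complex.I)) -
        (∫ x in (-T)..T, F (x + δ * Complex.I) / (x + δ * Complex.I)) -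
        F 0 * (4 * Complex.I * (arctan (T / δ) : ℝ)) =
      Complex.I * (∫ y in (-δ)..δ, dslope F 0 ((-T : ℝ) + y * Complex.I)) -
        Complex.I * ∫ y in (-δ)..δ, dslope F 0 (T + y * Complex.I) := by
    intro T hT
    have := Complex.integral_boundary_rect_eq_zero_of_continuousOn_of_differentiableOn
      (dslope F 0) (-T - δ * Complex.I) (T + δ * Complex.I) (by
        refine hG.continuousOn.mono fun z hz => ?_
        rw [Complex.mem_reProdIm] at hz
        have := hz.2
        simp only [Complex.sub_im, Complex.neg_im, Complex.ofReal_im, Complex.mul_im,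
          Complex.ofReal_re, Complex.I_im, Complex.I_re, Complex.add_im] at this
        rw [Set.uIcc_of_le (by linarith)] at this
        exact (abs_le.2 ⟨by linarith [this.1], by linarith [this.2]⟩ : |z.im| ≤ δ).trans_lt hδd)
      (by
        refine hG.mono fun z hz => ?_
        rw [Complex.mem_reProdIm] at hz
        have := hz.2
        simp only [Complex.sub_im, Complex.neg_im, Complex.ofReal_im, Complex.mul_im,
          Complex.ofReal_re, Complex.I_im, Complex.I_re, Complex.add_im] at this
        rw [min_eq_left (by linarith), max_eq_right (by linarith)] at this
        exact (abs_le.2 ⟨by linarith [this.1], by linarith [this.2]⟩ : |z.im| ≤ δ).trans_lt hδd)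
    simp only [Complex.sub_im, Complex.neg_im, Complex.ofReal_im, Complex.mul_im,
      Complex.ofReal_re, Complex.I_im, Complex.I_re, Complex.add_im, Complex.sub_re,
      Complex.neg_re, Complex.mul_re, Complex.add_re, mul_zero, mul_one, sub_zero,
      add_zero, neg_zero, zero_sub, zero_add, smul_eq_mul] at this
    have e1 : ∫ x in (-T)..T, dslope F 0 (x + (-δ : ℝ) * Complex.I) =
        (∫ x in (-T)..T, F (x - δ * Complex.I) / (x - δ * Complex.I)) -
        F 0 * ∫ x in (-T)..T, 1 / ((x : ℂ) - δ * Complex.I) := by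
      rw [← intervalIntegral.integral_const_mul, ← intervalIntegral.integral_sub
        (q1.intervalIntegrable _ _) ((d1.const_mul _).intervalIntegrable _ _)]
      refine intervalIntegral.integral_congr fun x _ => ?_
      have : (x + (-δ : ℝ) * Complex.I : ℂ) = x - δ * Complex.I := by push_cast; ring
      simp only [this]
      rw [dslope_of_ne _ (ne1 x), slope_def_field, sub_zero]
      ring
    have e2 : ∫ x in (-T)..T, dslope F 0 (x + δ * Complex.I) =
        (∫ x in (-T)..T, F (x + δ * Complex.I) / (x + δ * Complex.I)) -
        F 0 * ∫ x in (-T)..T, 1 / ((x : ℂ) + δ * Complex.I) := by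
      rw [← intervalIntegral.integral_const_mul, ← intervalIntegral.integral_sub
        (q2.intervalIntegrable _ _) ((d2.const_mul _).intervalIntegrable _ _)]
      refine intervalIntegral.integral_congr fun x _ => ?_
      rw [dslope_of_ne _ (ne2 x), slope_def_field, sub_zero]
      ring
    rw [e1, e2] at this
    have e3 := integral_inv_sub_inv_conj δ T hδ
    linear_combination this + F 0 * e3
  have int1 : Integrable fun x : ℝ => F (x - δ * Complex.I) / (x - δ * Complex.I) := by
    refine (h1.norm.div_const δ).mono' q1.aestronglyMeasurable
      (Filter.Eventually.of_forall fun x => ?_)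
    rw [norm_div]
    have := (le_norm_strip_line_sub x 0 δ hδ).1
    simp only [Complex.ofReal_zero, sub_zero] at this
    gcongr
  have int2 : Integrable fun x : ℝ => F (x + δ * Complex.I) / (x + δ * Complex.I) := by
    refine (h2.norm.div_const δ).mono' q2.aestronglyMeasurable
      (Filter.Eventually.of_forall fun x => ?_)
    rw [norm_div]
    have := (le_norm_strip_line_sub x 0 δ hδ).2
    simp only [Complex.ofReal_zero, sub_zero] at this
    gcongr
  have l1 := intervalIntegral_tendsto_integral int1 Filter.tendsto_neg_atTop_atBot
    Filter.tendsto_id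
  have l2 := intervalIntegral_tendsto_integral int2 Filter.tendsto_neg_atTop_atBot
    Filter.tendsto_id
  have l3 : Filter.Tendsto (fun T : ℝ => F 0 * (4 * Complex.I * (arctan (T / δ) : ℝ)))
      Filter.atTop (nhds (F 0 * (4 * Complex.I * ((π / 2 : ℝ) : ℂ)))) := by
    refine Filter.Tendsto.const_mul _ (Filter.Tendsto.const_mul _ ?_)
    refine (Complex.continuous_ofReal.tendsto _).comp ?_
    exact (tendsto_arctan_atTop.mono_right nhdsWithin_le_nhds).comp
      (Filter.tendsto_id.atTop_div_const hδ)
  have l4 : Filter.Tendsto (fun T : ℝ =>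
      (∫ x in (-T)..T, F (x - δ * Complex.I) / (x - δ * Complex.I)) -
        (∫ x in (-T)..T, F (x + δ * Complex.I) / (x + δ * Complex.I)) -
        F 0 * (4 * Complex.I * (arctan (T / δ) : ℝ))) Filter.atTop (nhds 0) := by
    refine squeeze_zero_norm' (a := fun T : ℝ => (8 * C * δ) * T⁻¹) ?_ ?_
    · filter_upwards [Filter.eventually_gt_atTop 0] with T hT
      rw [rect T hT]
      have v1 := vert T hT (-T) (by rw [abs_neg, abs_of_pos hT])
      have v2 := vert T hT T (abs_of_pos hT)
      refine (norm_sub_le _ _).trans ?_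
      rw [norm_mul, norm_mul, Complex.norm_I, one_mul, one_mul]
      refine (add_le_add v1 v2).trans (le_of_eq ?_)
      field_simp
      ring
    · simpa using (tendsto_inv_atTop_zero (𝕜 := ℝ)).const_mul (8 * C * δ)
  have := tendsto_nhds_unique l4 ((l1.sub l2).sub l3)
  push_cast at this
  linear_combination -this

/-- Cauchy's integral formula for the strip `|Im ζ| ≤ δ`, at a real point. -/
theorem cauchy_formula_strip {F : ℂ → ℂ} {d δ C : ℝ} (hδ : 0 < δ) (hδd : δ < d)
    (hF : DifferentiableOn ℂ F (strip d)) (hC : ∀ z : ℂ, |z.im| ≤ δ → ‖F z‖ ≤ C)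
    (h1 : Integrable fun x : ℝ => F (x - δ * Complex.I))
    (h2 : Integrable fun x : ℝ => F (x + δ * Complex.I)) (t : ℝ) :
    (∫ x : ℝ, F (x - δ * Complex.I) / (x - δ * Complex.I - t)) -
      ∫ x : ℝ, F (x + δ * Complex.I) / (x + δ * Complex.I - t) =
      2 * π * Complex.I * F t := by
  have e1 : ∀ x : ℝ, ((x + t : ℝ) : ℂ) - δ * Complex.I = x - δ * Complex.I + t := fun x => by
    push_cast; ring
  have e2 : ∀ x : ℝ, ((x + t : ℝ) : ℂ) + δ * Complex.I = x + δ * Complex.I + t := fun x => by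
    push_cast; ring
  have := cauchy_formula_strip_zero (F := fun z => F (z + t)) hδ hδd
    (hF.comp (by fun_prop) fun z hz => by simpa [strip] using hz)
    (fun z hz => hC _ (by simpa using hz))
    (by simpa only [e1] using h1.comp_add_right t) (by simpa only [e2] using h2.comp_add_right t)
  rw [zero_add] at this
  rw [← this, ← integral_add_right_eq_self _ t,
    ← integral_add_right_eq_self (fun x : ℝ => F (x + δ * Complex.I) / _) t]
  simp only [e1, e2, add_sub_cancel_right]

/-! ### The complex sine from below, and an oscillatory integral -/

/-- This follows from |sin(x + iy)|² = sin² x + sinh² y. -/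
theorem sinh_le_norm_sin (z : ℂ) : sinh |z.im| ≤ ‖Complex.sin z‖ := by
  apply le_of_sq_le_sq _ (norm_nonneg _)
  have e : Complex.sin z = ((sin z.re * cosh z.im : ℝ) : ℂ) +
      ((cos z.re * sinh z.im : ℝ) : ℂ) * Complex.I := by
    rw [Complex.sin_eq]; push_cast; rfl
  rw [e, ← Complex.normSq_eq_norm_sq, Complex.normSq_add_mul_I]
  have h1 : sinh |z.im| ^ 2 = sinh z.im ^ 2 := by
    rcases abs_choice z.im with h | h <;> rw [h]
    rw [sinh_neg, neg_sq]
  have h2 := cosh_sq z.im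
  have h3 := sin_sq_add_cos_sq z.re
  rw [h1, mul_pow, mul_pow, h2]
  nlinarith [sq_nonneg (sin z.re)]

/-- This puts the boundary terms of an integration by parts into arctangent form, so that they
cancel against the remaining integral. -/
theorem inv_sqrt_one_add_sq_le (u : ℝ) : 1 / √(1 + u ^ 2) ≤ π / 2 - arctan u := by
  rw [← cos_arctan, ← sin_pi_div_two_sub]
  exact sin_le (by linarith [arctan_lt_pi_div_two u])

theorem norm_sub_ofReal_eq (w : ℂ) (δ : ℝ) (hδ : 0 < δ) (hw : |w.im| = δ) (s : ℝ) :
    ‖w - s‖ = δ * √(1 + ((s - w.re) / δ) ^ 2) := by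
  rw [Complex.norm_eq_sqrt_sq_add_sq]
  simp only [Complex.sub_re, Complex.ofReal_re, Complex.sub_im, Complex.ofReal_im, sub_zero]
  rw [← sq_abs w.im, hw]
  have : δ * √(1 + ((s - w.re) / δ) ^ 2) = √(δ ^ 2 * (1 + ((s - w.re) / δ) ^ 2)) := by
    rw [sqrt_mul (sq_nonneg δ), sqrt_sq hδ.le]
  rw [this]
  congr 1
  field_simp
  ring

/-- The oscillatory integral of the Cauchy kernel against `sin (π s / h)` along a real interval. -/
theorem norm_integral_sin_div_le (w : ℂ) (δ h a b : ℝ) (hδ : 0 < δ) (hh : 0 < h)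
    (hw : |w.im| = δ) (hab : a ≤ b) :
    ‖∫ s in a..b, Complex.sin (π * (s / h)) / (w - s)‖ ≤ h / δ := by
  have ne : ∀ s : ℝ, w - s ≠ 0 := fun s h0 => by
    have := congrArg Complex.im h0
    simp at this
    rw [this] at hw
    simp at hw
    linarith
  have hh' : (h : ℂ) ≠ 0 := by exact_mod_cast hh.ne'
  have hp : (π : ℂ) ≠ 0 := by exact_mod_cast pi_ne_zero
  have du : ∀ s : ℝ, HasDerivAt (fun s : ℝ => (w - s)⁻¹) (((w - s) ^ 2)⁻¹) s := by
    intro s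
    have h1 : HasDerivAt (fun z : ℂ => (w - z)⁻¹) (((w - s) ^ 2)⁻¹) s := by
      refine HasDerivAt.congr_deriv (((hasDerivAt_id (s : ℂ)).const_sub w).inv (ne s)) ?_
      simp
    exact h1.comp_ofReal
  have dv : ∀ s : ℝ, HasDerivAt (fun s : ℝ => -(h / π) * Complex.cos (π * (s / h)))
      (Complex.sin (π * (s / h))) s := by
    intro s
    have h1 : HasDerivAt (fun z : ℂ => -(h / π) * Complex.cos (π * (z / h)))
        (Complex.sin (π * (s / h))) s := by
      refine HasDerivAt.congr_deriv (((((hasDerivAt_id (s : ℂ)).div_const (h : ℂ)).const_mul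
        (π : ℂ)).ccos).const_mul (-(h / π : ℂ))) ?_
      simp only [id]
      field_simp
    exact h1.comp_ofReal
  have cu : Continuous fun s : ℝ => ((w - s) ^ 2)⁻¹ :=
    Continuous.inv₀ (by fun_prop) fun s => pow_ne_zero 2 (ne s)
  -- Integrating the sine gains a factor h/π and leaves 1/(w - s)², which is absolutely integrable
  -- over the whole line; hence a bound independent of a and b.
  have parts := intervalIntegral.integral_mul_deriv_eq_deriv_mul (a := a) (b := b)
    (fun s _ => du s) (fun s _ => dv s) (cu.intervalIntegrable _ _)
    (Continuous.intervalIntegrable (by fun_prop) _ _)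
  have e0 : ∫ s in a..b, Complex.sin (π * (s / h)) / (w - s) =
      ∫ s in a..b, (w - s)⁻¹ * Complex.sin (π * (s / h)) :=
    intervalIntegral.integral_congr fun s _ => by simp only [div_eq_mul_inv, mul_comm]
  rw [e0, parts]
  have ncos : ∀ s : ℝ, ‖-(h / π : ℂ) * Complex.cos (π * (s / h))‖ ≤ h / π := by
    intro s
    have : (π * (s / h) : ℂ) = ((π * (s / h) : ℝ) : ℂ) := by push_cast; rfl
    rw [norm_mul, this, ← Complex.ofReal_cos, Complex.norm_real, norm_neg, norm_div,
      Complex.norm_real, Complex.norm_real, Real.norm_eq_abs, Real.norm_eq_abs, Real.norm_eq_abs,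
      abs_of_pos hh, abs_of_pos pi_pos]
    exact mul_le_of_le_one_right (by positivity) (abs_cos_le_one _)
  have nb : ‖(w - b)⁻¹‖ ≤ 1 / δ * (π / 2 - arctan ((b - w.re) / δ)) := by
    rw [norm_inv, norm_sub_ofReal_eq w δ hδ hw, mul_inv, ← one_div, ← one_div]
    gcongr
    exact inv_sqrt_one_add_sq_le _
  have na : ‖(w - a)⁻¹‖ ≤ 1 / δ * (π / 2 + arctan ((a - w.re) / δ)) := by
    rw [norm_inv, norm_sub_ofReal_eq w δ hδ hw, mul_inv, ← one_div, ← one_div]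
    gcongr
    have := inv_sqrt_one_add_sq_le (-((a - w.re) / δ))
    rwa [neg_sq, arctan_neg, sub_neg_eq_add] at this
  have ni : ‖∫ s in a..b, ((w - s) ^ 2)⁻¹ * (-(h / π) * Complex.cos (π * (s / h)))‖ ≤
      h / π * (1 / δ * (arctan ((b - w.re) / δ) - arctan ((a - w.re) / δ))) := by
    have hd : ∀ s ∈ Set.uIcc a b, HasDerivAt (fun s : ℝ => 1 / δ * arctan ((s - w.re) / δ))
        (1 / δ * (1 / (1 + ((s - w.re) / δ) ^ 2) * (1 / δ))) s := fun s _ =>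
      ((((hasDerivAt_id s).sub_const w.re).div_const δ).arctan).const_mul (1 / δ)
    have ci : IntervalIntegrable
        (fun s : ℝ => 1 / δ * (1 / (1 + ((s - w.re) / δ) ^ 2) * (1 / δ))) volume a b := by
      apply Continuous.intervalIntegrable
      exact Continuous.mul continuous_const (Continuous.mul (Continuous.div (by fun_prop)
        (by fun_prop) fun x => by positivity) (by fun_prop))
    rw [mul_sub, ← intervalIntegral.integral_eq_sub_of_hasDerivAt hd ci,
      ← intervalIntegral.integral_const_mul]
    refine intervalIntegral.norm_integral_le_of_norm_le hab
      (Filter.Eventually.of_forall fun s _ => ?_) (ci.const_mul _)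
    rw [norm_mul, mul_comm]
    refine mul_le_mul (ncos s) (le_of_eq ?_) (norm_nonneg _) (by positivity)
    rw [norm_inv, norm_pow, norm_sub_ofReal_eq w δ hδ hw, mul_pow, sq_sqrt (by positivity)]
    field_simp
  refine (norm_sub_le _ _).trans ((add_le_add (norm_sub_le _ _) ni).trans ?_)
  rw [norm_mul (w - b)⁻¹, norm_mul (w - a)⁻¹]
  have m1 := mul_le_mul nb (ncos b) (norm_nonneg _) ((norm_nonneg _).trans nb)
  have m2 := mul_le_mul na (ncos a) (norm_nonneg _) ((norm_nonneg _).trans na)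
  -- The arctangents at a and b cancel, leaving (h/π)(1/δ)(π/2 + π/2) = h/δ.
  refine (add_le_add_left (add_le_add m1 m2) _).trans (le_of_eq ?_)
  field_simp
  ring

/-! ### The Sinc series inside line integrals -/

theorem le_norm_line_sub (x t η δ : ℝ) (hη : |η| = δ) :
    δ ≤ ‖(x : ℂ) + η * Complex.I - t‖ := by
  refine le_trans ?_ (Complex.abs_im_le_norm _)
  simp [hη]

theorem summable_inv_one_add_abs_int_sq : Summable fun k : ℤ => 1 / (1 + |(k : ℝ)|) ^ 2 := by
  have h : Summable fun n : ℕ => 1 / (1 + (n : ℝ)) ^ 2 := by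
    have := (summable_nat_add_iff 1).2 (summable_one_div_nat_pow.2 (one_lt_two))
    refine this.congr fun n => ?_
    push_cast
    rw [add_comm]
  exact Summable.of_nat_of_neg (by simpa using h) (by simpa using h)

/-- This gives one factor 1/|k|. The Cauchy kernel gives a second in `one_add_abs_le_norm_line`, at
the price of a weight 1 + |x|; together the terms are O(k⁻²). -/
theorem one_add_abs_mul_abs_sinc_le (s h : ℝ) (k : ℤ) :
    (1 + |(k : ℝ)|) * |sinc (π * (s / h - k))| ≤ 2 + |s / h| := by
  set y := s / h with hy
  have h1 := abs_sinc_le_one (π * (y - k))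
  have h2 : |y - k| * |sinc (π * (y - k))| ≤ 1 := by
    rcases eq_or_ne (y - k) 0 with h0 | h0
    · simp [h0]
    · have hne : π * (y - k) ≠ 0 := mul_ne_zero pi_ne_zero h0
      rw [sinc_of_ne_zero hne, abs_div, abs_mul, abs_of_pos pi_pos, mul_div_left_comm,
        div_mul_cancel_right₀ (abs_ne_zero.2 h0)]
      have := abs_sin_le_one (π * (y - k))
      rw [← div_eq_mul_inv, div_le_one pi_pos]
      linarith [pi_gt_three]
  have h3 : |(k : ℝ)| ≤ |y| + |y - k| := by
    have := abs_sub y (y - k)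
    simpa using this
  nlinarith [abs_nonneg (sinc (π * (y - k))), abs_nonneg y]

theorem one_add_abs_le_norm_line (x η δ h : ℝ) (hδ : 0 < δ) (hη : |η| = δ) (hh : 0 < h)
    (k : ℤ) :
    (1 + |(k : ℝ)|) ≤
      (1 / δ + 1 / h + 1 / (δ * h)) * ((1 + |x|) * ‖(x : ℂ) + η * Complex.I - (k * h : ℝ)‖) := by
  set N := ‖(x : ℂ) + η * Complex.I - (k * h : ℝ)‖ with hN
  have h1 : δ ≤ N := le_norm_line_sub x (k * h) η δ hη
  have h2 : |x - k * h| ≤ N := by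
    refine le_trans (le_of_eq ?_) (Complex.abs_re_le_norm _)
    simp
  have h3 : |(k : ℝ)| * h ≤ N + |x| := by
    have := abs_sub x (x - k * h)
    rw [sub_sub_cancel, abs_mul, abs_of_pos hh] at this
    linarith
  have hx := abs_nonneg x
  have h4 : |x| ≤ N * |x| / δ := by
    rw [le_div_iff₀ hδ]; nlinarith
  have h5 : |(k : ℝ)| ≤ (N + N * |x| / δ) / h := by
    rw [le_div_iff₀ hh]; linarith
  have h6 : 1 ≤ N / δ := by rw [one_le_div hδ]; exact h1
  have h7 : 0 ≤ N := hδ.le.trans h1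
  have e : (1 / δ + 1 / h + 1 / (δ * h)) * ((1 + |x|) * N) =
      N / δ + (N + N * |x| / δ) / h + (N * |x| / δ + N * |x| / h + N / (δ * h)) := by
    field_simp
    ring
  rw [e]
  have : 0 ≤ N * |x| / δ + N * |x| / h + N / (δ * h) := by positivity
  linarith

theorem continuous_cauchy_line {g : ℝ → ℂ} (hg : Continuous g) (η δ : ℝ) (hδ : 0 < δ)
    (hη : |η| = δ) (t : ℝ) : Continuous fun x : ℝ => g x / (x + η * Complex.I - t) :=
  Continuous.div hg (by fun_prop) fun x => by
    rw [← norm_pos_iff]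
    exact hδ.trans_le (le_norm_line_sub x t η δ hη)

theorem sinh_le_norm_sin_line (x η δ h : ℝ) (hη : |η| = δ) (hh : 0 < h) :
    sinh (π * δ / h) ≤ ‖Complex.sin (π * ((x + η * Complex.I) / h))‖ := by
  refine le_trans (le_of_eq ?_) (sinh_le_norm_sin _)
  have : (π * ((x + η * Complex.I) / h) : ℂ) =
    ((π * x / h : ℝ) : ℂ) + ((π * η / h : ℝ) : ℂ) * Complex.I := by push_cast; ring
  rw [this]
  simp [abs_div, abs_mul, abs_of_pos pi_pos, abs_of_pos hh, hη]

/-- The integrand of the contour remainder of Sinc interpolation on the line `Im ζ = η`. -/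
noncomputable def lineRemainder (g : ℝ → ℂ) (η h s x : ℝ) : ℂ :=
  g x * (Complex.sin (π * (s / h)) /
    ((x + η * Complex.I - s) * Complex.sin (π * ((x + η * Complex.I) / h))))

theorem continuous_lineRemainder {g : ℝ → ℂ} (hg : Continuous g) (η δ h : ℝ) (hδ : 0 < δ)
    (hη : |η| = δ) (hh : 0 < h) :
    Continuous (Function.uncurry (lineRemainder g η h)) := by
  unfold Function.uncurry lineRemainder
  refine Continuous.mul (by fun_prop) (Continuous.div (by fun_prop) (by fun_prop) fun p => ?_)
  refine mul_ne_zero ?_ ?_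
  · rw [← norm_pos_iff]
    exact hδ.trans_le (le_norm_line_sub p.2 p.1 η δ hη)
  · rw [← norm_pos_iff]
    exact (sinh_pos_iff.2 (by positivity)).trans_le (sinh_le_norm_sin_line p.2 η δ h hη hh)

theorem norm_lineRemainder_le (g : ℝ → ℂ) (η δ h s x : ℝ) (hδ : 0 < δ) (hη : |η| = δ)
    (hh : 0 < h) :
    ‖lineRemainder g η h s x‖ ≤ ‖g x‖ * (1 / (δ * sinh (π * δ / h))) := by
  have hs : 0 < sinh (π * δ / h) := sinh_pos_iff.2 (by positivity)
  unfold lineRemainder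
  rw [norm_mul, norm_div, norm_mul]
  have h1 := le_norm_line_sub x s η δ hη
  have h2 := sinh_le_norm_sin_line x η δ h hη hh
  have h3 : ‖Complex.sin (π * (s / h))‖ ≤ 1 := by
    have : (π * (s / h) : ℂ) = ((π * (s / h) : ℝ) : ℂ) := by push_cast; rfl
    rw [this, ← Complex.ofReal_sin, Complex.norm_real]
    exact abs_sin_le_one _
  gcongr

/-- This is `hasSum_sinc_div` integrated against g along the line. The weighted integrability of g
pays for the factor 1 + |x| in the k⁻² bound and so permits exchanging sum and integral. -/
theorem hasSum_cauchy_line_mul_sinc {g : ℝ → ℂ} (hg : Continuous g) (η δ h : ℝ) (hδ : 0 < δ)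
    (hη : |η| = δ) (hh : 0 < h) (hint : Integrable fun x : ℝ => (1 + |x|) * ‖g x‖)
    (s : ℝ) (hs : ∀ k : ℤ, s ≠ k * h) :
    HasSum (fun k : ℤ => (∫ x : ℝ, g x / (x + η * Complex.I - (k * h : ℝ))) *
        (sinc (π * (s / h - k)) : ℂ))
      ((∫ x : ℝ, g x / (x + η * Complex.I - s)) - ∫ x : ℝ, lineRemainder g η h s x) := by
  have hgi : Integrable g := by
    refine hint.mono' hg.aestronglyMeasurable (Filter.Eventually.of_forall fun x => ?_)
    nlinarith [norm_nonneg (g x), abs_nonneg x, mul_nonneg (abs_nonneg x) (norm_nonneg (g x))]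
  have cauchyInt : ∀ t : ℝ, Integrable fun x : ℝ => g x / (x + η * Complex.I - t) := by
    intro t
    refine (hgi.norm.div_const δ).mono' (continuous_cauchy_line hg η δ hδ hη t).aestronglyMeasurable
      (Filter.Eventually.of_forall fun x => ?_)
    rw [norm_div]
    have := le_norm_line_sub x t η δ hη
    gcongr
  set C := (2 + |s / h|) * (1 / δ + 1 / h + 1 / (δ * h)) with hC
  have bound : ∀ (k : ℤ) (x : ℝ),
      ‖g x / (x + η * Complex.I - (k * h : ℝ)) * (sinc (π * (s / h - k)) : ℂ)‖ ≤
        (C * (1 / (1 + |(k : ℝ)|) ^ 2)) * ((1 + |x|) * ‖g x‖) := by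
    intro k x
    have b1 := one_add_abs_mul_abs_sinc_le s h k
    have b2 := one_add_abs_le_norm_line x η δ h hδ hη hh k
    have b3 : 0 < ‖(x : ℂ) + η * Complex.I - (k * h : ℝ)‖ :=
      hδ.trans_le (le_norm_line_sub x (k * h) η δ hη)
    rw [norm_mul, norm_div, Complex.norm_real, Real.norm_eq_abs]
    set N := ‖(x : ℂ) + η * Complex.I - (k * h : ℝ)‖
    have b4 : 0 < 1 + |(k : ℝ)| := by positivity
    rw [mul_one_div, div_mul_eq_mul_div, div_mul_eq_mul_div, div_le_div_iff₀ b3 (by positivity)]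
    have b5 := mul_le_mul b1 b2 b4.le (by positivity)
    calc ‖g x‖ * |sinc (π * (s / h - k))| * (1 + |(k : ℝ)|) ^ 2
        = ‖g x‖ * ((1 + |(k : ℝ)|) * |sinc (π * (s / h - k))| * (1 + |(k : ℝ)|)) := by ring
      _ ≤ ‖g x‖ * ((2 + |s / h|) * ((1 / δ + 1 / h + 1 / (δ * h)) * ((1 + |x|) * N))) := by
          gcongr
      _ = C * ((1 + |x|) * ‖g x‖) * N := by rw [hC]; ring
  have intTerm : ∀ k : ℤ, Integrable fun x : ℝ =>
      g x / (x + η * Complex.I - (k * h : ℝ)) * (sinc (π * (s / h - k)) : ℂ) :=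
    fun k => (cauchyInt (k * h)).mul_const _
  have summ : Summable fun k : ℤ => ∫ x : ℝ,
      ‖g x / (x + η * Complex.I - (k * h : ℝ)) * (sinc (π * (s / h - k)) : ℂ)‖ := by
    refine Summable.of_nonneg_of_le (fun k => integral_nonneg fun x => norm_nonneg _)
      (fun k => ?_) ((summable_inv_one_add_abs_int_sq.mul_left C).mul_right
        (∫ x : ℝ, (1 + |x|) * ‖g x‖))
    rw [← integral_const_mul]
    exact integral_mono (intTerm k).norm (hint.const_mul _) (bound k)
  have key := hasSum_integral_of_summable_integral_norm intTerm summ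
  have remInt : Integrable (lineRemainder g η h s) := by
    have c : Continuous (lineRemainder g η h s) :=
      (continuous_lineRemainder hg η δ h hδ hη hh).comp (Continuous.prodMk_right s)
    exact (hgi.norm.mul_const _).mono' c.aestronglyMeasurable
      (Filter.Eventually.of_forall fun x => norm_lineRemainder_le g η δ h s x hδ hη hh)
  have e : ∀ x : ℝ, ∑' k : ℤ,
      g x / (x + η * Complex.I - (k * h : ℝ)) * (sinc (π * (s / h - k)) : ℂ) =
      g x / (x + η * Complex.I - s) - lineRemainder g η h s x := by
    intro x
    have him : ((x : ℂ) + η * Complex.I).im ≠ 0 := by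
      simp only [Complex.add_im, Complex.ofReal_im, Complex.mul_im, Complex.ofReal_re,
        Complex.I_im, Complex.I_re]
      intro h0
      have : η = 0 := by linarith
      rw [this, abs_zero] at hη
      linarith
    have := (hasSum_sinc_div h hh s hs _ him).mul_left (g x)
    have e2 : g x / (x + η * Complex.I - s) - lineRemainder g η h s x =
        g x * (1 / (x + η * Complex.I - s) - Complex.sin (π * (s / h)) /
          ((x + η * Complex.I - s) * Complex.sin (π * ((x + η * Complex.I) / h)))) := by
      unfold lineRemainder
      ring
    rw [e2, ← this.tsum_eq]
    refine tsum_congr fun k => ?_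
    push_cast
    ring
  simp_rw [e] at key
  rw [integral_sub (cauchyInt s) remInt] at key
  refine key.congr_fun fun k => ?_
  rw [integral_mul_const]

theorem integrable_lineRemainder_prod {g : ℝ → ℂ} (hg : Continuous g) (hgi : Integrable g)
    (η δ h a b : ℝ) (hδ : 0 < δ) (hη : |η| = δ) (hh : 0 < h) :
    Integrable (Function.uncurry (lineRemainder g η h))
      ((volume.restrict (Set.uIoc a b)).prod volume) := by
  have hfin : IsFiniteMeasure (volume.restrict (Set.uIoc a b)) := by
    unfold Set.uIoc
    infer_instance
  have h1 : Integrable (fun p : ℝ × ℝ => (1 : ℝ) * (‖g p.2‖ * (1 / (δ * sinh (π * δ / h)))))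
      ((volume.restrict (Set.uIoc a b)).prod volume) :=
    Integrable.mul_prod (f := fun _ : ℝ => (1 : ℝ)) (integrable_const _) (hgi.norm.mul_const _)
  refine h1.mono' (continuous_lineRemainder hg η δ h hδ hη hh).aestronglyMeasurable
    (Filter.Eventually.of_forall fun p => ?_)
  rw [one_mul]
  exact norm_lineRemainder_le g η δ h p.1 p.2 hδ hη hh

theorem intervalIntegrable_integral_lineRemainder {g : ℝ → ℂ} (hg : Continuous g)
    (hgi : Integrable g) (η δ h a b : ℝ) (hδ : 0 < δ) (hη : |η| = δ) (hh : 0 < h) :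
    IntervalIntegrable (fun s => ∫ x : ℝ, lineRemainder g η h s x) volume a b := by
  rw [intervalIntegrable_iff]
  exact (integrable_lineRemainder_prod hg hgi η δ h a b hδ hη hh).integral_prod_left

/-- Integrating in s before taking norms exploits the oscillation of sin(πs/h). The pointwise bound
`norm_lineRemainder_le` would grow with b - a. -/
theorem norm_integral_lineRemainder_le {g : ℝ → ℂ} (hg : Continuous g)
    (hgi : Integrable g) (η δ h a b : ℝ) (hδ : 0 < δ) (hη : |η| = δ) (hh : 0 < h)
    (hab : a ≤ b) :
    ‖∫ s in a..b, ∫ x : ℝ, lineRemainder g η h s x‖ ≤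
      (∫ x : ℝ, ‖g x‖) * (h / (δ * sinh (π * δ / h))) := by
  have hs : 0 < sinh (π * δ / h) := sinh_pos_iff.2 (by positivity)
  rw [intervalIntegral_integral_swap (integrable_lineRemainder_prod hg hgi η δ h a b hδ hη hh),
    ← integral_mul_const]
  refine norm_integral_le_of_norm_le (hgi.norm.mul_const _)
    (Filter.Eventually.of_forall fun x => ?_)
  have e : ∀ s : ℝ, lineRemainder g η h s x =
      g x / Complex.sin (π * ((x + η * Complex.I) / h)) *
        (Complex.sin (π * (s / h)) / (x + η * Complex.I - s)) := by
    intro s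
    unfold lineRemainder
    simp only [div_eq_mul_inv, mul_inv]
    ring
  simp_rw [e]
  rw [intervalIntegral.integral_const_mul, norm_mul, norm_div]
  have h1 := norm_integral_sin_div_le (x + η * Complex.I) δ h a b hδ hh (by simp [hη]) hab
  have h2 := sinh_le_norm_sin_line x η δ h hη hh
  calc _ ≤ ‖g x‖ / sinh (π * δ / h) * (h / δ) := by gcongr
    _ = _ := by field_simp

/-- The contour remainder of Sinc interpolation on the two lines `Im ζ = ∓δ`. -/
noncomputable def stripRemainder (F : ℂ → ℂ) (δ h s : ℝ) : ℂ :=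
  ((∫ x : ℝ, lineRemainder (fun x : ℝ => F (x + (-δ : ℝ) * Complex.I)) (-δ) h s x) -
    ∫ x : ℝ, lineRemainder (fun x : ℝ => F (x + δ * Complex.I)) δ h s x) / (2 * π * Complex.I)

theorem continuous_strip_line {F : ℂ → ℂ} {d η δ : ℝ} (hη : |η| = δ) (hδd : δ < d)
    (hF : DifferentiableOn ℂ F (strip d)) : Continuous fun x : ℝ => F (x + η * Complex.I) :=
  hF.continuousOn.comp_continuous (by fun_prop) fun x => by
    simpa [strip, hη] using hδd

theorem integrable_of_integrable_weighted {g : ℝ → ℂ} (hg : Continuous g)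
    (hint : Integrable fun x : ℝ => (1 + |x|) * ‖g x‖) : Integrable g := by
  refine hint.mono' hg.aestronglyMeasurable (Filter.Eventually.of_forall fun x => ?_)
  nlinarith [norm_nonneg (g x), mul_nonneg (abs_nonneg x) (norm_nonneg (g x))]

/-! ### Sinc interpolation and indefinite integration on a strip -/

section

variable {F : ℂ → ℂ} {d δ C h : ℝ}

theorem hasSum_sinc_interpolation (hδ : 0 < δ) (hδd : δ < d)
    (hF : DifferentiableOn ℂ F (strip d)) (hC : ∀ z : ℂ, |z.im| ≤ δ → ‖F z‖ ≤ C)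
    (h1 : Integrable fun x : ℝ => (1 + |x|) * ‖F (x + (-δ : ℝ) * Complex.I)‖)
    (h2 : Integrable fun x : ℝ => (1 + |x|) * ‖F (x + δ * Complex.I)‖) (hh : 0 < h)
    (s : ℝ) (hs : ∀ k : ℤ, s ≠ k * h) :
    HasSum (fun k : ℤ => F (k * h : ℝ) * (sinc (π * (s / h - k)) : ℂ))
      (F s - stripRemainder F δ h s) := by
  have n1 : |-δ| = δ := by rw [abs_neg, abs_of_pos hδ]
  have n2 : |δ| = δ := abs_of_pos hδ
  have g1 := continuous_strip_line n1 hδd hF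
  have g2 := continuous_strip_line n2 hδd hF
  have i1 := integrable_of_integrable_weighted g1 h1
  have i2 := integrable_of_integrable_weighted g2 h2
  have s1 := hasSum_cauchy_line_mul_sinc g1 (-δ) δ h hδ n1 hh h1 s hs
  have s2 := hasSum_cauchy_line_mul_sinc g2 δ δ h hδ n2 hh h2 s hs
  have e1 : ∀ x : ℝ, (x : ℂ) + (-δ : ℝ) * Complex.I = x - δ * Complex.I := fun x => by
    push_cast; ring
  have cf := cauchy_formula_strip hδ hδd hF hC (by simpa only [e1] using i1) i2
  simp only [← e1] at cf
  have hp : (2 * π * Complex.I : ℂ) ≠ 0 := by simp [pi_ne_zero]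
  have key := (s1.sub s2).div_const (2 * π * Complex.I)
  have e2 : F s - stripRemainder F δ h s =
      ((∫ x : ℝ, F (x + (-δ : ℝ) * Complex.I) / (x + (-δ : ℝ) * Complex.I - s)) -
        (∫ x : ℝ, lineRemainder (fun x : ℝ => F (x + (-δ : ℝ) * Complex.I)) (-δ) h s x) -
        ((∫ x : ℝ, F (x + δ * Complex.I) / (x + δ * Complex.I - s)) -
        ∫ x : ℝ, lineRemainder (fun x : ℝ => F (x + δ * Complex.I)) δ h s x)) /
        (2 * π * Complex.I) := by
    rw [eq_div_iff hp, stripRemainder, sub_mul, div_mul_cancel₀ _ hp]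
    linear_combination -cf s
  rw [e2]
  refine key.congr_fun fun k => ?_
  rw [← sub_mul, cf (k * h)]
  field_simp

theorem intervalIntegrable_stripRemainder (hδ : 0 < δ) (hδd : δ < d)
    (hF : DifferentiableOn ℂ F (strip d))
    (h1 : Integrable fun x : ℝ => (1 + |x|) * ‖F (x + (-δ : ℝ) * Complex.I)‖)
    (h2 : Integrable fun x : ℝ => (1 + |x|) * ‖F (x + δ * Complex.I)‖) (hh : 0 < h)
    (a b : ℝ) : IntervalIntegrable (stripRemainder F δ h) volume a b := by
  have n1 : |-δ| = δ := by rw [abs_neg, abs_of_pos hδ]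
  have n2 : |δ| = δ := abs_of_pos hδ
  have g1 := continuous_strip_line n1 hδd hF
  have g2 := continuous_strip_line n2 hδd hF
  exact ((intervalIntegrable_integral_lineRemainder g1 (integrable_of_integrable_weighted g1 h1)
    (-δ) δ h a b hδ n1 hh).sub (intervalIntegrable_integral_lineRemainder g2
    (integrable_of_integrable_weighted g2 h2) δ δ h a b hδ n2 hh)).div_const _

theorem norm_integral_stripRemainder_le (hδ : 0 < δ) (hδd : δ < d)
    (hF : DifferentiableOn ℂ F (strip d))
    (h1 : Integrable fun x : ℝ => (1 + |x|) * ‖F (x + (-δ : ℝ) * Complex.I)‖)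
    (h2 : Integrable fun x : ℝ => (1 + |x|) * ‖F (x + δ * Complex.I)‖) (hh : 0 < h)
    (a b : ℝ) (hab : a ≤ b) :
    ‖∫ s in a..b, stripRemainder F δ h s‖ ≤
      ((∫ x : ℝ, ‖F (x + (-δ : ℝ) * Complex.I)‖) + ∫ x : ℝ, ‖F (x + δ * Complex.I)‖) *
        (h / (2 * π * δ * sinh (π * δ / h))) := by
  have n1 : |-δ| = δ := by rw [abs_neg, abs_of_pos hδ]
  have n2 : |δ| = δ := abs_of_pos hδ
  have g1 := continuous_strip_line n1 hδd hF
  have g2 := continuous_strip_line n2 hδd hF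
  have i1 := integrable_of_integrable_weighted g1 h1
  have i2 := integrable_of_integrable_weighted g2 h2
  have b1 := norm_integral_lineRemainder_le g1 i1 (-δ) δ h a b hδ n1 hh hab
  have b2 := norm_integral_lineRemainder_le g2 i2 δ δ h a b hδ n2 hh hab
  unfold stripRemainder
  rw [intervalIntegral.integral_div, intervalIntegral.integral_sub
    (intervalIntegrable_integral_lineRemainder g1 i1 (-δ) δ h a b hδ n1 hh)
    (intervalIntegrable_integral_lineRemainder g2 i2 δ δ h a b hδ n2 hh), norm_div]
  have e : ‖(2 * π * Complex.I : ℂ)‖ = 2 * π := by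
    simp [abs_of_pos pi_pos]
  rw [e, div_le_iff₀ (by positivity)]
  refine (norm_sub_le _ _).trans ((add_le_add b1 b2).trans (le_of_eq ?_))
  field_simp

theorem hasSum_mul_J_sub (hδ : 0 < δ) (hδd : δ < d)
    (hF : DifferentiableOn ℂ F (strip d)) (hC : ∀ z : ℂ, |z.im| ≤ δ → ‖F z‖ ≤ C)
    (h1 : Integrable fun x : ℝ => (1 + |x|) * ‖F (x + (-δ : ℝ) * Complex.I)‖)
    (h2 : Integrable fun x : ℝ => (1 + |x|) * ‖F (x + δ * Complex.I)‖) (hh : 0 < h)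
    (hs : Summable fun k : ℤ => ‖F (k * h : ℝ)‖) (a b : ℝ) :
    HasSum (fun k : ℤ => F (k * h : ℝ) * ((J k h b : ℂ) - J k h a))
      (∫ s in a..b, (F s - stripRemainder F δ h s)) := by
  -- The interpolation expansion was proved off the nodes only, which form a null set.
  have hae : ∀ᵐ s : ℝ, ∀ k : ℤ, s ≠ k * h := by
    rw [ae_all_iff]
    intro k
    exact Measure.ae_ne volume _
  have key := intervalIntegral.hasSum_integral_of_dominated_convergence (μ := volume)
    (a := a) (b := b)
    (F := fun (k : ℤ) (s : ℝ) => F (k * h : ℝ) * (sinc (π * (s / h - k)) : ℂ))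
    (f := fun s => F s - stripRemainder F δ h s)
    (fun k _ => ‖F (k * h : ℝ)‖)
    (fun k => Continuous.aestronglyMeasurable (by fun_prop))
    (fun k => Filter.Eventually.of_forall fun s _ => by
      rw [norm_mul, Complex.norm_real]
      exact mul_le_of_le_one_right (norm_nonneg _) (abs_sinc_le_one _))
    (Filter.Eventually.of_forall fun s _ => hs) (intervalIntegrable_const)
    (by
      filter_upwards [hae] with s hs' _
      exact hasSum_sinc_interpolation hδ hδd hF hC h1 h2 hh s hs')
  refine key.congr_fun fun k => ?_
  rw [intervalIntegral.integral_const_mul, intervalIntegral.integral_ofReal,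
    integral_sinc_eq_J_sub k h a b hh, Complex.ofReal_sub]

/-- The discretization error of Sinc indefinite integration. -/
theorem norm_integral_Iic_sub_tsum_le (hδ : 0 < δ) (hδd : δ < d)
    (hF : DifferentiableOn ℂ F (strip d)) (hC : ∀ z : ℂ, |z.im| ≤ δ → ‖F z‖ ≤ C)
    (h1 : Integrable fun x : ℝ => (1 + |x|) * ‖F (x + (-δ : ℝ) * Complex.I)‖)
    (h2 : Integrable fun x : ℝ => (1 + |x|) * ‖F (x + δ * Complex.I)‖) (hh : 0 < h)
    (hs : Summable fun k : ℤ => ‖F (k * h : ℝ)‖) (hFi : Integrable fun x : ℝ => F x) (b : ℝ) :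
    ‖(∫ s in Set.Iic b, F s) - ∑' k : ℤ, F (k * h : ℝ) * (J k h b : ℂ)‖ ≤
      ((∫ x : ℝ, ‖F (x + (-δ : ℝ) * Complex.I)‖) + ∫ x : ℝ, ‖F (x + δ * Complex.I)‖) *
        (h / (2 * π * δ * sinh (π * δ / h))) := by
  have l1 : Filter.Tendsto (fun a : ℝ => ∫ s in a..b, F s) Filter.atBot
      (nhds (∫ s in Set.Iic b, F s)) :=
    intervalIntegral_tendsto_integral_Iic b hFi.integrableOn Filter.tendsto_id
  -- Dominated convergence for series: J(k,h)(a) → 0 for each k as a → -∞, while |J| ≤ 1.1h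
  -- uniformly and the samples are summable.
  have l2 : Filter.Tendsto
      (fun a : ℝ => ∑' k : ℤ, F (k * h : ℝ) * ((J k h b : ℂ) - J k h a)) Filter.atBot
      (nhds (∑' k : ℤ, F (k * h : ℝ) * (J k h b : ℂ))) := by
    refine tendsto_tsum_of_dominated_convergence (hs.mul_right (1.1 * h + 1.1 * h))
      (fun k => ?_) (Filter.Eventually.of_forall fun a k => ?_)
    · have := ((Complex.continuous_ofReal.tendsto _).comp (tendsto_J_atBot k h hh)).const_sub
        (J k h b : ℂ)
      simpa using this.const_mul (F (k * h : ℝ))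
    · rw [norm_mul]
      gcongr
      refine (norm_sub_le _ _).trans (add_le_add ?_ ?_)
      · rw [Complex.norm_real]; exact abs_J_le k h b hh
      · rw [Complex.norm_real]; exact abs_J_le k h a hh
  refine le_of_tendsto (l1.sub l2).norm ?_
  filter_upwards [Filter.eventually_le_atBot b] with a hab
  rw [(hasSum_mul_J_sub hδ hδd hF hC h1 h2 hh hs a b).tsum_eq, intervalIntegral.integral_sub
    hFi.intervalIntegrable (intervalIntegrable_stripRemainder hδ hδd hF h1 h2 hh a b),
    sub_sub_cancel]
  exact norm_integral_stripRemainder_le hδ hδd hF h1 h2 hh a b hab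

end

/-! ### Two-sided exponential decay and truncation -/

/-- `g` decays like `A exp (-α |x|)` to the left and like `A exp (-β |x|)` to the right. -/
def TwoSidedExpDecay (g : ℝ → ℂ) (A α β : ℝ) : Prop :=
  ∀ x : ℝ, (x ≤ 0 → ‖g x‖ ≤ A * exp (α * x)) ∧ (0 ≤ x → ‖g x‖ ≤ A * exp (-β * x))

/-- Half of the decay rate absorbs the weight 1 + |x|; the other half keeps the product integrable.
-/
theorem one_add_le_mul_exp (γ u : ℝ) (hγ : 0 < γ) (hu : 0 ≤ u) :
    1 + u ≤ (1 + 2 / γ) * exp (γ / 2 * u) := by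
  have h1 : 1 + γ / 2 * u ≤ exp (γ / 2 * u) := by linarith [add_one_le_exp (γ / 2 * u)]
  calc 1 + u ≤ (1 + 2 / γ) * (1 + γ / 2 * u) := by
        have : (1 + 2 / γ) * (1 + γ / 2 * u) = 1 + u + (2 / γ + γ / 2 * u) := by
          field_simp
          ring
        rw [this]
        have : 0 ≤ 2 / γ + γ / 2 * u := by positivity
        linarith
    _ ≤ _ := by gcongr

/-- With r = e^{-γh} the tail is e^{-γNh} r/(1 - r), and r/(1 - r) ≤ 1/(γh) because 1 + γh ≤ e^{γh}.
The factor 1/h later cancels the h in |J| ≤ 1.1h. -/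
theorem hasSum_exp_tail (γ h : ℝ) (hγ : 0 < γ) (hh : 0 < h) (N : ℤ) :
    ∃ S ≤ exp (-(γ * (N * h))) / (γ * h),
      HasSum (fun k : ℤ => if N < k then exp (-γ * (k * h)) else 0) S := by
  have hgh : 0 < γ * h := by positivity
  set r := exp (-(γ * h)) with hr
  have r0 : 0 < r := exp_pos _
  have r1 : r < 1 := by
    rw [hr, ← exp_zero]
    exact exp_lt_exp.2 (by linarith)
  have hs := (hasSum_geometric_of_lt_one r0.le r1).mul_left (exp (-γ * ((N + 1 : ℤ) * h)))
  refine ⟨_, ?_, ((Function.Injective.hasSum_iff (g := fun j : ℕ => N + 1 + (j : ℤ))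
    (fun a b hab => by simpa using hab) ?_).1 (hs.congr_fun fun j => ?_))⟩
  · have e1 : exp (-γ * ((N + 1 : ℤ) * h)) = exp (-(γ * (N * h))) * r := by
      rw [hr, ← exp_add]; push_cast; ring_nf
    rw [e1, mul_assoc, div_eq_mul_inv]
    gcongr
    rw [← div_eq_mul_inv, div_le_iff₀ (by linarith), ← div_eq_inv_mul, le_div_iff₀ hgh]
    have : r * (1 + γ * h) ≤ 1 := by
      have h1 : 1 + γ * h ≤ exp (γ * h) := by linarith [add_one_le_exp (γ * h)]
      calc r * (1 + γ * h) ≤ r * exp (γ * h) := by gcongr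
        _ = 1 := by rw [hr, ← exp_add]; simp
    linarith
  · intro k hk
    rw [if_neg]
    intro hN
    exact hk ⟨(k - (N + 1)).toNat, by
      simp only
      rw [Int.toNat_of_nonneg (by omega)]
      ring⟩
  · simp only [Function.comp_apply]
    rw [if_pos (by omega), hr, ← exp_nat_mul, ← exp_add]
    push_cast
    ring_nf

theorem hasSum_exp_tail_neg (γ h : ℝ) (hγ : 0 < γ) (hh : 0 < h) (M : ℤ) :
    ∃ S ≤ exp (-(γ * (M * h))) / (γ * h),
      HasSum (fun k : ℤ => if k < -M then exp (γ * (k * h)) else 0) S := by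
  obtain ⟨S, hS, hsum⟩ := hasSum_exp_tail γ h hγ hh M
  refine ⟨S, hS, ?_⟩
  rw [← (Equiv.neg ℤ).hasSum_iff]
  refine hsum.congr_fun fun k => ?_
  simp only [Function.comp_apply, Equiv.neg_apply, neg_lt_neg_iff]
  push_cast
  ring_nf

section

variable {g : ℝ → ℂ} {A α β : ℝ}

theorem TwoSidedExpDecay.nonneg (hg : TwoSidedExpDecay g A α β) : 0 ≤ A := by
  have := (norm_nonneg _).trans ((hg 0).1 le_rfl)
  simpa using this

theorem TwoSidedExpDecay.integrable_weighted (hg : TwoSidedExpDecay g A α β)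
    (hc : Continuous g) (hα : 0 < α) (hβ : 0 < β) :
    Integrable fun x : ℝ => (1 + |x|) * ‖g x‖ := by
  have hA := hg.nonneg
  rw [← integrableOn_univ, ← Set.Iic_union_Ioi (a := (0 : ℝ)), integrableOn_union]
  constructor
  · refine ((integrableOn_exp_mul_Iic (half_pos hα) 0).const_mul (A * (1 + 2 / α))).mono'
      (by fun_prop) ((ae_restrict_iff' measurableSet_Iic).2 (Filter.Eventually.of_forall
      fun x hx => ?_))
    have hx : x ≤ 0 := hx
    rw [norm_of_nonneg (by positivity), abs_of_nonpos hx]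
    have h1 := one_add_le_mul_exp α (-x) hα (by linarith)
    have h2 := (hg x).1 hx
    have e : exp (α / 2 * x) = exp (α / 2 * -x) * exp (α * x) := by
      rw [← exp_add]; ring_nf
    calc (1 + -x) * ‖g x‖ ≤ ((1 + 2 / α) * exp (α / 2 * -x)) * (A * exp (α * x)) := by gcongr
      _ = _ := by rw [e]; ring
  · refine ((integrableOn_exp_mul_Ioi (neg_lt_zero.2 (half_pos hβ)) 0).const_mul
      (A * (1 + 2 / β))).mono'
      (by fun_prop) ((ae_restrict_iff' measurableSet_Ioi).2 (Filter.Eventually.of_forall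
      fun x hx => ?_))
    have hx : 0 ≤ x := le_of_lt hx
    rw [norm_of_nonneg (by positivity), abs_of_nonneg hx]
    have h1 := one_add_le_mul_exp β x hβ hx
    have h2 := (hg x).2 hx
    have e : exp (-(β / 2) * x) = exp (β / 2 * x) * exp (-β * x) := by
      rw [← exp_add]; ring_nf
    calc (1 + x) * ‖g x‖ ≤ ((1 + 2 / β) * exp (β / 2 * x)) * (A * exp (-β * x)) := by gcongr
      _ = _ := by rw [e]; ring

theorem TwoSidedExpDecay.integrable (hg : TwoSidedExpDecay g A α β)
    (hc : Continuous g) (hα : 0 < α) (hβ : 0 < β) : Integrable g :=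
  integrable_of_integrable_weighted hc (hg.integrable_weighted hc hα hβ)

theorem TwoSidedExpDecay.integral_norm_le (hg : TwoSidedExpDecay g A α β)
    (hc : Continuous g) (hα : 0 < α) (hβ : 0 < β) : ∫ x, ‖g x‖ ≤ A / α + A / β := by
  have hi := (hg.integrable hc hα hβ).norm
  have hA := hg.nonneg
  rw [← intervalIntegral.integral_Iic_add_Ioi (b := (0 : ℝ)) hi.integrableOn hi.integrableOn]
  refine add_le_add ?_ ?_
  · have : A / α = ∫ x in Set.Iic (0 : ℝ), A * exp (α * x) := by
      rw [integral_const_mul, integral_exp_mul_Iic hα]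
      simp [div_eq_mul_inv]
    rw [this]
    exact setIntegral_mono_on hi.integrableOn
      ((integrableOn_exp_mul_Iic hα 0).const_mul A) measurableSet_Iic fun x hx => (hg x).1 hx
  · have : A / β = ∫ x in Set.Ioi (0 : ℝ), A * exp (-β * x) := by
      rw [integral_const_mul, integral_exp_mul_Ioi (neg_lt_zero.2 hβ)]
      simp [div_eq_mul_inv]
    rw [this]
    exact setIntegral_mono_on hi.integrableOn
      ((integrableOn_exp_mul_Ioi (neg_lt_zero.2 hβ) 0).const_mul A) measurableSet_Ioi
      fun x hx => (hg x).2 (le_of_lt hx)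

theorem TwoSidedExpDecay.norm_le_tails (hg : TwoSidedExpDecay g A α β) (h : ℝ) (hh : 0 < h)
    (M N k : ℤ) (hM : 0 ≤ M) (hN : -1 ≤ N) (hk : k ∉ Finset.Icc (-M) N) :
    ‖g (k * h)‖ ≤ A * ((if k < -M then exp (α * (k * h)) else 0) +
      if N < k then exp (-β * (k * h)) else 0) := by
  have hA := hg.nonneg
  rw [Finset.mem_Icc, not_and_or, not_le, not_le] at hk
  rcases hk with hk | hk
  · have hk0 : (k : ℝ) ≤ 0 := by exact_mod_cast (by omega : k ≤ 0)
    rw [if_pos hk]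
    refine ((hg _).1 (mul_nonpos_of_nonpos_of_nonneg hk0 hh.le)).trans ?_
    gcongr
    refine le_add_of_nonneg_right ?_
    split_ifs <;> positivity
  · have hk0 : (0 : ℝ) ≤ k := by exact_mod_cast (by omega : 0 ≤ k)
    rw [if_pos hk]
    refine ((hg _).2 (mul_nonneg hk0 hh.le)).trans ?_
    gcongr
    refine le_add_of_nonneg_left ?_
    split_ifs <;> positivity

theorem TwoSidedExpDecay.summable_norm (hg : TwoSidedExpDecay g A α β) (hα : 0 < α)
    (hβ : 0 < β) (h : ℝ) (hh : 0 < h) : Summable fun k : ℤ => ‖g (k * h)‖ := by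
  obtain ⟨S1, -, h1⟩ := hasSum_exp_tail_neg α h hα hh 0
  obtain ⟨S2, -, h2⟩ := hasSum_exp_tail β h hβ hh (-1)
  exact Summable.of_nonneg_of_le (fun k => norm_nonneg _)
    -- With M = 0 and N = -1 the summation window is empty, so the two tails cover all of ℤ.
    (fun k => hg.norm_le_tails h hh 0 (-1) k le_rfl le_rfl (by simp))
    ((h1.add h2).mul_left A).summable

/-- The truncation error of a two-sided series with weights bounded by `B`. -/
theorem TwoSidedExpDecay.norm_tsum_sub_sum_le (hg : TwoSidedExpDecay g A α β) (hα : 0 < α)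
    (hβ : 0 < β) (h : ℝ) (hh : 0 < h) (M N : ℤ) (hM : 0 ≤ M) (hN : 0 ≤ N) (w : ℤ → ℂ) (B : ℝ)
    (hw : ∀ k, ‖w k‖ ≤ B) :
    ‖(∑' k : ℤ, g (k * h) * w k) - ∑ k ∈ Finset.Icc (-M) N, g (k * h) * w k‖ ≤
      B * A * (exp (-(α * (M * h))) / (α * h) + exp (-(β * (N * h))) / (β * h)) := by
  obtain ⟨S1, l1, h1⟩ := hasSum_exp_tail_neg α h hα hh M
  obtain ⟨S2, l2, h2⟩ := hasSum_exp_tail β h hβ hh N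
  have hA := hg.nonneg
  have hB : 0 ≤ B := (norm_nonneg _).trans (hw 0)
  have hsum : Summable fun k : ℤ => g (k * h) * w k := by
    refine Summable.of_norm_bounded ((hg.summable_norm hα hβ h hh).mul_right B) fun k => ?_
    rw [norm_mul]
    gcongr
    exact hw k
  have hfin : HasSum (fun k : ℤ => if k ∈ Finset.Icc (-M) N then g (k * h) * w k else 0)
      (∑ k ∈ Finset.Icc (-M) N, g (k * h) * w k) := by
    have : HasSum (fun k : ℤ => if k ∈ Finset.Icc (-M) N then g (k * h) * w k else 0)
        (∑ k ∈ Finset.Icc (-M) N, if k ∈ Finset.Icc (-M) N then g (k * h) * w k else 0) :=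
      hasSum_sum_of_ne_finset_zero fun k hk => if_neg hk
    rwa [Finset.sum_congr rfl fun k hk => if_pos hk] at this
  have key := (hsum.hasSum.sub hfin).norm_le_of_bounded ((h1.add h2).mul_left (B * A))
    fun k => by
      by_cases hk : k ∈ Finset.Icc (-M) N
      · rw [if_pos hk, sub_self, norm_zero]
        refine mul_nonneg (mul_nonneg hB hA) (add_nonneg ?_ ?_) <;> split_ifs <;> positivity
      · rw [if_neg hk, sub_zero, norm_mul, mul_comm, mul_assoc]
        exact mul_le_mul (hw k) (hg.norm_le_tails h hh M N k hM (by omega) hk)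
          (norm_nonneg _) hB
  refine key.trans ?_
  gcongr

end

/-! ### Transport to the strip by sinh -/

/-- The real part of cosh(x + iy) is cosh x cos y, which alone suffices. -/
theorem exp_abs_mul_cos_le_norm_cosh (z : ℂ) (δ : ℝ) (hδ : δ < π / 2) (hz : |z.im| ≤ δ) :
    exp |z.re| / 2 * cos δ ≤ ‖Complex.cosh z‖ := by
  have e : Complex.cosh z = ((cosh z.re * cos z.im : ℝ) : ℂ) +
      ((sinh z.re * sin z.im : ℝ) : ℂ) * Complex.I := by
    conv_lhs => rw [← Complex.re_add_im z, Complex.cosh_add, Complex.cosh_mul_I,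
      Complex.sinh_mul_I]
    push_cast
    ring
  have hcos : cos δ ≤ cos z.im := by
    rw [← cos_abs z.im]
    exact cos_le_cos_of_nonneg_of_le_pi (abs_nonneg _) (by linarith [pi_pos]) hz
  have hcos0 : 0 ≤ cos δ := cos_nonneg_of_neg_pi_div_two_le_of_le
    (by linarith [abs_nonneg z.im, pi_pos]) hδ.le
  have hcosh : exp |z.re| / 2 ≤ cosh z.re := by
    rw [← cosh_abs, cosh_eq]
    linarith [exp_pos (-|z.re|)]
  calc exp |z.re| / 2 * cos δ ≤ cosh z.re * cos z.im := by gcongr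
    _ ≤ |(Complex.cosh z).re| := by
      rw [e]
      simp only [Complex.add_re, Complex.mul_re, Complex.ofReal_re, Complex.ofReal_im,
        Complex.I_re, Complex.I_im, mul_zero, mul_one, sub_zero, add_zero]
      exact le_abs_self _
    _ ≤ _ := Complex.abs_re_le_norm _

/-- As 1 + sinh² = cosh² and the exponent is real, the norm does not see the branch of the power. -/
theorem norm_E1_sinh (z : ℂ) (γ : ℝ) :
    ‖E1 (Complex.sinh z) γ‖ = 1 / ‖Complex.cosh z‖ ^ (γ + 1) := by
  unfold E1
  rw [add_comm 1, ← Complex.cosh_sq, norm_div, norm_one, Complex.norm_cpow_real, norm_pow,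
    ← rpow_natCast, ← rpow_mul (norm_nonneg _)]
  congr 2
  push_cast
  ring

/-- The integrand transported to the strip by the change of variables `z = sinh ζ`. -/
noncomputable def pullback (f : ℂ → ℂ) (ζ : ℂ) : ℂ := f (Complex.sinh ζ) * Complex.cosh ζ

/-- The Jacobian cosh cancels one power, leaving K/|cosh z|^γ. Raising γ to ν in the constant, but
not in the decay, lets both half strips share one constant. -/
theorem norm_pullback_le {f : ℂ → ℂ} {K γ ν δ : ℝ} (hK : 0 < K) (hγ : 0 < γ) (hν : γ ≤ ν)
    (hδ : δ < π / 2) (z : ℂ) (hz : |z.im| ≤ δ)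
    (hf : ‖f (Complex.sinh z)‖ ≤ K * ‖E1 (Complex.sinh z) γ‖) :
    ‖pullback f z‖ ≤ K * 2 ^ ν / cos δ ^ ν * exp (-γ * |z.re|) := by
  have hcos0 : 0 < cos δ := cos_pos_of_mem_Ioo
    ⟨by linarith [abs_nonneg z.im, pi_pos], hδ⟩
  have hb := exp_abs_mul_cos_le_norm_cosh z δ hδ hz
  have hp : 0 < exp |z.re| / 2 * cos δ := by positivity
  have hc : 0 < ‖Complex.cosh z‖ := hp.trans_le hb
  rw [norm_E1_sinh] at hf
  unfold pullback
  rw [norm_mul]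
  calc ‖f (Complex.sinh z)‖ * ‖Complex.cosh z‖
      ≤ K * (1 / ‖Complex.cosh z‖ ^ (γ + 1)) * ‖Complex.cosh z‖ := by gcongr
    _ = K / ‖Complex.cosh z‖ ^ γ := by
      rw [rpow_add hc, rpow_one]
      field_simp
    _ ≤ K / (exp |z.re| / 2 * cos δ) ^ γ := by gcongr
    _ = K * 2 ^ γ / cos δ ^ γ * exp (-γ * |z.re|) := by
      rw [mul_rpow (by positivity) hcos0.le, div_rpow (by positivity) (by positivity), ← exp_mul,
        neg_mul, exp_neg, mul_comm γ]
      field_simp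
    _ ≤ K * 2 ^ ν / cos δ ^ ν * exp (-γ * |z.re|) := by
      have h1 : (2 : ℝ) ^ γ ≤ 2 ^ ν := rpow_le_rpow_of_exponent_le (by norm_num) hν
      have h2 : cos δ ^ ν ≤ cos δ ^ γ :=
        rpow_le_rpow_of_exponent_ge hcos0 (cos_le_one _) hν
      gcongr

/-- The change of variables `t = sinh x` on a half line. -/
theorem integral_Iic_comp_sinh (f : ℂ → ℂ) (τ : ℝ) :
    ∫ t in Set.Iic τ, f (t : ℂ) = ∫ x in Set.Iic (arsinh τ), pullback f (x : ℝ) := by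
  have himg : sinh '' Set.Iic (arsinh τ) = Set.Iic τ := by
    ext t
    constructor
    · rintro ⟨x, hx, rfl⟩
      have := sinh_le_sinh.2 hx
      rwa [sinh_arsinh] at this
    · intro ht
      exact ⟨arsinh t, arsinh_le_arsinh.2 ht, sinh_arsinh t⟩
  rw [← himg, integral_image_eq_integral_abs_deriv_smul measurableSet_Iic
    (fun x _ => (hasDerivAt_sinh x).hasDerivWithinAt) sinh_injective.injOn]
  refine integral_congr_ae (Filter.Eventually.of_forall fun x => ?_)
  simp only [pullback, abs_of_pos (cosh_pos x), Complex.real_smul, Complex.ofReal_sinh,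
    Complex.ofReal_cosh]
  ring

theorem integrable_of_integrable_pullback (f : ℂ → ℂ)
    (hf : Integrable fun x : ℝ => pullback f x) : Integrable fun t : ℝ => f t := by
  have key := integrableOn_image_iff_integrableOn_abs_deriv_smul MeasurableSet.univ
    (fun x _ => (hasDerivAt_sinh x).hasDerivWithinAt) sinh_injective.injOn
    (fun t : ℝ => f t)
  rw [Set.image_univ, sinh_surjective.range_eq, integrableOn_univ, integrableOn_univ] at key
  refine key.2 (hf.congr (Filter.Eventually.of_forall fun x => ?_))
  simp only [pullback, abs_of_pos (cosh_pos x), Complex.real_smul, Complex.ofReal_sinh,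
    Complex.ofReal_cosh]
  ring

section

variable {f : ℂ → ℂ} {d K α β : ℝ}

theorem differentiableOn_pullback (hf : AnalyticOnNhd ℂ f (Complex.sinh '' strip d)) :
    DifferentiableOn ℂ (pullback f) (strip d) := by
  refine DifferentiableOn.mul ?_ Complex.differentiable_cosh.differentiableOn
  exact hf.differentiableOn.comp Complex.differentiable_sinh.differentiableOn
    fun z hz => Set.mem_image_of_mem _ hz

theorem norm_pullback_le_of_strip (hd' : d < π / 2) (hK : 0 < K) (hα : 0 < α) (hβ : 0 < β)
    (hneg : ∀ z ∈ Complex.sinh '' stripNeg d, ‖f z‖ ≤ K * ‖E1 z α‖)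
    (hpos : ∀ z ∈ Complex.sinh '' stripPos d, ‖f z‖ ≤ K * ‖E1 z β‖)
    {δ : ℝ} (hδd : δ < d) (z : ℂ) (hz : |z.im| ≤ δ) :
    (z.re ≤ 0 → ‖pullback f z‖ ≤ K * 2 ^ max α β / cos δ ^ max α β * exp (α * z.re)) ∧
    (0 ≤ z.re → ‖pullback f z‖ ≤ K * 2 ^ max α β / cos δ ^ max α β * exp (-β * z.re)) := by
  have hs : z ∈ strip d := hz.trans_lt hδd
  have P : 0 ≤ z.re →
      ‖pullback f z‖ ≤ K * 2 ^ max α β / cos δ ^ max α β * exp (-β * z.re) := by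
    intro h
    have := norm_pullback_le hK hβ (le_max_right α β) (hδd.trans hd') z hz
      (hpos _ (Set.mem_image_of_mem _ ⟨hs, h⟩))
    rwa [abs_of_nonneg h] at this
  refine ⟨fun h => ?_, P⟩
  -- `stripNeg` omits the imaginary axis; there the right-hand estimate is used, both exponentials
  -- being 1.
  rcases h.eq_or_lt with h0 | h0
  · have := P h0.ge
    rw [h0] at this ⊢
    simpa using this
  · have := norm_pullback_le hK hα (le_max_left α β) (hδd.trans hd') z hz
      (hneg _ (Set.mem_image_of_mem _ ⟨hs, h0⟩))
    rwa [abs_of_neg h0, neg_mul_neg] at this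

theorem twoSidedExpDecay_pullback_line (hd' : d < π / 2) (hK : 0 < K) (hα : 0 < α) (hβ : 0 < β)
    (hneg : ∀ z ∈ Complex.sinh '' stripNeg d, ‖f z‖ ≤ K * ‖E1 z α‖)
    (hpos : ∀ z ∈ Complex.sinh '' stripPos d, ‖f z‖ ≤ K * ‖E1 z β‖)
    {δ η : ℝ} (hδd : δ < d) (hη : |η| = δ) :
    TwoSidedExpDecay (fun x : ℝ => pullback f (x + η * Complex.I))
      (K * 2 ^ max α β / cos δ ^ max α β) α β := by
  intro x
  have := norm_pullback_le_of_strip hd' hK hα hβ hneg hpos hδd (x + η * Complex.I)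
    (by simp [hη])
  simpa using this

theorem twoSidedExpDecay_pullback (hd : 0 < d) (hd' : d < π / 2) (hK : 0 < K) (hα : 0 < α)
    (hβ : 0 < β) (hneg : ∀ z ∈ Complex.sinh '' stripNeg d, ‖f z‖ ≤ K * ‖E1 z α‖)
    (hpos : ∀ z ∈ Complex.sinh '' stripPos d, ‖f z‖ ≤ K * ‖E1 z β‖) :
    TwoSidedExpDecay (fun x : ℝ => pullback f x) (K * 2 ^ max α β) α β := by
  simpa using twoSidedExpDecay_pullback_line hd' hK hα hβ hneg hpos hd abs_zero

theorem continuous_pullback_ofReal (hd : 0 < d)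
    (hf : AnalyticOnNhd ℂ f (Complex.sinh '' strip d)) :
    Continuous fun x : ℝ => pullback f x := by
  simpa using continuous_strip_line abs_zero hd (differentiableOn_pullback hf)

theorem norm_discretization_error_le (hd : 0 < d) (hd' : d < π / 2) (hK : 0 < K) (hα : 0 < α)
    (hβ : 0 < β) (hf : AnalyticOnNhd ℂ f (Complex.sinh '' strip d))
    (hneg : ∀ z ∈ Complex.sinh '' stripNeg d, ‖f z‖ ≤ K * ‖E1 z α‖)
    (hpos : ∀ z ∈ Complex.sinh '' stripPos d, ‖f z‖ ≤ K * ‖E1 z β‖) {h : ℝ} (hh : 0 < h)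
    (b : ℝ) :
    ‖(∫ s in Set.Iic b, pullback f (s : ℝ)) -
        ∑' k : ℤ, pullback f (k * h : ℝ) * (J k h b : ℂ)‖ ≤
      2 * (K * 2 ^ max α β / cos d ^ max α β / α + K * 2 ^ max α β / cos d ^ max α β / β) *
        (h / (2 * π * d * sinh (π * d / h))) := by
  have hcos : 0 < cos d := cos_pos_of_mem_Ioo ⟨by linarith, hd'⟩
  have hreal := twoSidedExpDecay_pullback hd hd' hK hα hβ hneg hpos
  have hF := differentiableOn_pullback hf
  -- Nothing is known about f on the boundary lines |Im ζ| = d, so the estimate is proved for δ < d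
  -- and passes to the limit; the right side is continuous at d since cos d > 0.
  have hT : Filter.Tendsto (fun δ : ℝ =>
      2 * (K * 2 ^ max α β / cos δ ^ max α β / α + K * 2 ^ max α β / cos δ ^ max α β / β) *
        (h / (2 * π * δ * sinh (π * δ / h)))) (nhdsWithin d (Set.Iio d))
      (nhds (2 * (K * 2 ^ max α β / cos d ^ max α β / α +
        K * 2 ^ max α β / cos d ^ max α β / β) * (h / (2 * π * d * sinh (π * d / h))))) := by
    refine Filter.Tendsto.mono_left (ContinuousAt.tendsto ?_) nhdsWithin_le_nhds
    have hpow : ContinuousAt (fun δ : ℝ => cos δ ^ max α β) d :=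
      continuous_cos.continuousAt.rpow_const (Or.inl hcos.ne')
    have hq : ContinuousAt (fun δ : ℝ => K * 2 ^ max α β / cos δ ^ max α β) d :=
      continuousAt_const.div hpow (rpow_pos_of_pos hcos _).ne'
    have hsinh : 0 < sinh (π * d / h) := sinh_pos_iff.2 (by positivity)
    refine (continuousAt_const.mul ((hq.div_const α).add (hq.div_const β))).mul
      (continuousAt_const.div ?_ (by positivity))
    exact Continuous.continuousAt (by fun_prop)
  refine ge_of_tendsto hT ?_
  filter_upwards [Ioo_mem_nhdsLT hd] with δ hδ
  obtain ⟨hδ0, hδd⟩ := hδ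
  have n1 : |-δ| = δ := by rw [abs_neg, abs_of_pos hδ0]
  have n2 : |δ| = δ := abs_of_pos hδ0
  have D1 := twoSidedExpDecay_pullback_line hd' hK hα hβ hneg hpos hδd n1
  have D2 := twoSidedExpDecay_pullback_line hd' hK hα hβ hneg hpos hδd n2
  have g1 := continuous_strip_line n1 hδd hF
  have g2 := continuous_strip_line n2 hδd hF
  have hC : ∀ z : ℂ, |z.im| ≤ δ → ‖pullback f z‖ ≤ K * 2 ^ max α β / cos δ ^ max α β := by
    intro z hz
    have hb := norm_pullback_le_of_strip hd' hK hα hβ hneg hpos hδd z hz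
    have hA := D1.nonneg
    rcases le_total z.re 0 with hr | hr
    · refine (hb.1 hr).trans (mul_le_of_le_one_right hA ?_)
      rw [exp_le_one_iff]
      exact mul_nonpos_of_nonneg_of_nonpos hα.le hr
    · refine (hb.2 hr).trans (mul_le_of_le_one_right hA ?_)
      rw [exp_le_one_iff]
      nlinarith
  have key := norm_integral_Iic_sub_tsum_le hδ0 hδd hF hC (D1.integrable_weighted g1 hα hβ)
    (D2.integrable_weighted g2 hα hβ) hh (hreal.summable_norm hα hβ h hh)
    (hreal.integrable (continuous_pullback_ofReal hd hf) hα hβ) b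
  have hsinh : 0 < sinh (π * δ / h) := sinh_pos_iff.2 (by positivity)
  refine key.trans (mul_le_mul_of_nonneg_right ?_ (by positivity))
  linarith [D1.integral_norm_le g1 hα hβ, D2.integral_norm_le g2 hα hβ]

/-! ### Choice of parameters and the final estimate -/

/-- The truncation numbers enter the error estimate only through this inequality and its analogue
for `upperTrunc`. -/
theorem mul_le_mul_lowerTrunc (hα : 0 < α) (n : ℕ) :
    min α β * n ≤ α * (lowerTrunc α β n : ℤ) := by
  unfold lowerTrunc
  split_ifs with h
  · rw [h]; simp
  · have hm : min α β = β := (min_choice α β).resolve_left h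
    rw [hm]
    have := Int.le_ceil (β * n / α)
    rw [div_le_iff₀ hα] at this
    linarith

theorem mul_le_mul_upperTrunc (hβ : 0 < β) (n : ℕ) :
    min α β * n ≤ β * (upperTrunc α β n : ℤ) := by
  unfold upperTrunc
  split_ifs with h
  · rw [h]
    have := Int.le_ceil (α * n / β)
    rw [div_le_iff₀ hβ] at this
    linarith
  · have hm : min α β = β := (min_choice α β).resolve_left h
    rw [hm]; simp

theorem nonneg_of_mul_le {γ μ : ℝ} (hγ : 0 < γ) (hμ : 0 < μ) (n : ℕ) (M : ℤ)
    (h : μ * n ≤ γ * M) : 0 ≤ M := by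
  have h1 : 0 ≤ γ * (M : ℝ) := le_trans (by positivity) h
  exact_mod_cast nonneg_of_mul_nonneg_right h1 hγ

/-- E₀ will be the value of E at n = 1, which makes the denominator independent of n. -/
theorem inv_sinh_le {E E₀ : ℝ} (hE₀ : 0 < E₀) (hE : E₀ ≤ E) :
    1 / sinh E ≤ 2 * exp (-E) / (1 - exp (-2 * E₀)) := by
  have h1 : exp (-2 * E) ≤ exp (-2 * E₀) := exp_le_exp.2 (by linarith)
  have h2 : exp (-2 * E₀) < 1 := by
    rw [← exp_zero]
    exact exp_lt_exp.2 (by linarith)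
  have h3 : sinh E = (1 - exp (-2 * E)) / (2 * exp (-E)) := by
    rw [sinh_eq, show -2 * E = -E + -E by ring, exp_add, exp_neg]
    field_simp
  rw [h3, one_div_div]
  gcongr

theorem norm_error_le (hd : 0 < d) (hd' : d < π / 2) (hK : 0 < K) (hα : 0 < α)
    (hβ : 0 < β) (hf : AnalyticOnNhd ℂ f (Complex.sinh '' strip d))
    (hneg : ∀ z ∈ Complex.sinh '' stripNeg d, ‖f z‖ ≤ K * ‖E1 z α‖)
    (hpos : ∀ z ∈ Complex.sinh '' stripPos d, ‖f z‖ ≤ K * ‖E1 z β‖) (n : ℕ) (hn : 1 ≤ n)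
    (τ : ℝ) :
    ‖(∫ t in Set.Iic τ, f (t : ℂ)) - sincIndefSum f (meshSize d (min α β) n)
        (lowerTrunc α β n) (upperTrunc α β n) τ‖ ≤
      C1 d K α β * exp (-√(π * d * min α β * n)) := by
  have hMμ := mul_le_mul_lowerTrunc (β := β) hα n
  have hNμ := mul_le_mul_upperTrunc (α := α) hβ n
  have hμ : 0 < min α β := lt_min hα hβ
  set μ := min α β with hμdef
  set ν := max α β with hνdef
  set M := lowerTrunc α β n
  set N := upperTrunc α β n
  set h := meshSize d μ n with hhdef
  set b := arsinh τ
  have hn' : (1 : ℝ) ≤ n := by exact_mod_cast hn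
  have hn0 : (0 : ℝ) < n := by linarith
  have hh : 0 < h := sqrt_pos.2 (by positivity)
  have hcos : 0 < cos d := cos_pos_of_mem_Ioo ⟨by linarith, hd'⟩
  set E := √(π * d * μ * n) with hE
  -- This and `hnh` are the balance behind the mesh size: πd/h governs discretization, μnh governs
  -- truncation, and both equal E.
  have hhE : h * E = π * d := by
    rw [hhdef, meshSize, hE, ← sqrt_mul (by positivity),
      show π * d / (μ * n) * (π * d * μ * n) = (π * d) ^ 2 by field_simp,
      sqrt_sq (by positivity)]
  have hE' : π * d / h = E := by rw [← hhE]; field_simp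
  have hnh : μ * n * h = E := by
    have : π * d * μ * n = (μ * n) ^ 2 * (π * d / (μ * n)) := by field_simp
    rw [hE, this, sqrt_mul (by positivity), sqrt_sq (by positivity)]
    rfl
  -- The right side is the mesh size at n = 1.
  have hhle : h ≤ d * √(π / (d * μ)) := by
    have : d * √(π / (d * μ)) = √(π * d / μ) := by
      conv_lhs => rw [← sqrt_sq hd.le, ← sqrt_mul (by positivity)]
      rw [sqrt_sq hd.le]
      congr 1
      field_simp
    rw [this, hhdef, meshSize]
    apply sqrt_le_sqrt
    gcongr
    nlinarith
  have hE₀ : 0 < √(π * d * μ) := sqrt_pos.2 (by positivity)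
  have hEE : √(π * d * μ) ≤ E := by
    apply sqrt_le_sqrt
    exact le_mul_of_one_le_right (by positivity) hn'
  set q := exp (-2 * √(π * d * μ)) with hq
  have hq1 : q < 1 := by
    rw [hq, ← exp_zero]
    exact exp_lt_exp.2 (by linarith)
  -- discretization error
  have disc := norm_discretization_error_le hd hd' hK hα hβ hf hneg hpos hh b
  set A := K * 2 ^ ν / cos d ^ ν with hA
  have hA0 : 0 < A := by positivity
  have e1 : A / α ≤ A / μ := by gcongr; exact min_le_left _ _
  have e2 : A / β ≤ A / μ := by gcongr; exact min_le_right _ _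
  have disc' : 2 * (A / α + A / β) * (h / (2 * π * d * sinh (π * d / h))) ≤
      2 * A / μ * (1 / (1 - q) * √(π / (d * μ))) * exp (-E) := by
    rw [hE']
    have hsinh : 0 < sinh E := sinh_pos_iff.2 (hE₀.trans_le hEE)
    have i1 := inv_sinh_le hE₀ hEE
    rw [← hq] at i1
    have hq2 : 0 < 1 - q := by linarith
    calc 2 * (A / α + A / β) * (h / (2 * π * d * sinh E))
        = 2 * (A / α + A / β) * (h / (2 * π * d) * (1 / sinh E)) := by field_simp
      _ ≤ 2 * (A / μ + A / μ) *
          (d * √(π / (d * μ)) / (2 * π * d) * (2 * exp (-E) / (1 - q))) := by gcongr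
      _ = 2 / π * (2 * A / μ * (1 / (1 - q) * √(π / (d * μ))) * exp (-E)) := by
        field_simp
        ring
      -- The stated constant has room to spare here: the factor 2/π is discarded.
      _ ≤ 1 * (2 * A / μ * (1 / (1 - q) * √(π / (d * μ))) * exp (-E)) := by
        gcongr
        rw [div_le_one pi_pos]
        linarith [pi_gt_three]
      _ = _ := one_mul _
  -- truncation error
  have hreal := twoSidedExpDecay_pullback hd hd' hK hα hβ hneg hpos
  have trunc := hreal.norm_tsum_sub_sum_le hα hβ h hh M N (nonneg_of_mul_le hα hμ n M hMμ)
    (nonneg_of_mul_le hβ hμ n N hNμ) (fun k => (J k h b : ℂ)) (1.1 * h) fun k => by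
      rw [Complex.norm_real]
      exact abs_J_le k h b hh
  have trunc' : 1.1 * h * (K * 2 ^ ν) *
      (exp (-(α * (M * h))) / (α * h) + exp (-(β * (N * h))) / (β * h)) ≤
      2 * (K * 2 ^ ν) / μ * 1.1 * exp (-E) := by
    have x1 : exp (-(α * (M * h))) ≤ exp (-E) := by
      apply exp_le_exp.2
      have := mul_le_mul_of_nonneg_right hMμ hh.le
      linarith
    have x2 : exp (-(β * (N * h))) ≤ exp (-E) := by
      apply exp_le_exp.2
      have := mul_le_mul_of_nonneg_right hNμ hh.le
      linarith
    have y1 : μ ≤ α := min_le_left _ _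
    have y2 : μ ≤ β := min_le_right _ _
    calc 1.1 * h * (K * 2 ^ ν) *
          (exp (-(α * (M * h))) / (α * h) + exp (-(β * (N * h))) / (β * h))
        ≤ 1.1 * h * (K * 2 ^ ν) * (exp (-E) / (μ * h) + exp (-E) / (μ * h)) := by gcongr
      _ = _ := by field_simp; ring
  have hsum : sincIndefSum f h M N τ =
      ∑ k ∈ Finset.Icc (-M) N, pullback f (k * h : ℝ) * (J k h b : ℂ) := by
    unfold sincIndefSum pullback
    simp only [Complex.ofReal_sinh, Complex.ofReal_cosh]
    rfl
  have hC1 : C1 d K α β * exp (-E) =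
      2 * A / μ * (1 / (1 - q) * √(π / (d * μ))) * exp (-E) +
        2 * (K * 2 ^ ν) / μ * 1.1 * exp (-E) := by
    unfold C1
    rw [← hμdef, ← hνdef, ← hq, rpow_add two_pos, rpow_one, hA]
    have hq2 : 1 - q ≠ 0 := by linarith
    field_simp
  rw [integral_Iic_comp_sinh, hsum, hC1]
  calc _ ≤ _ := norm_sub_le_norm_sub_add_norm_sub _
        (∑' k : ℤ, pullback f (k * h : ℝ) * (J k h b : ℂ)) _
    _ ≤ _ := add_le_add (disc.trans disc') (trunc.trans trunc')

end

end SincIndef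

/-- The `BddAbove` clause gives the supremum its meaning, since a real `⨆` over an unbounded family
is 0 by default. -/
theorem theorem3p1 (d : ℝ) (hd : 0 < d) (hd' : d < Real.pi / 2)
    (f : ℂ → ℂ) (hf : AnalyticOnNhd ℂ f (Complex.sinh '' SincIndef.strip d))
    (K α β : ℝ) (hK : 0 < K) (hα : 0 < α) (hβ : 0 < β)
    (hneg : ∀ z ∈ Complex.sinh '' SincIndef.stripNeg d, ‖f z‖ ≤ K * ‖SincIndef.E1 z α‖)
    (hpos : ∀ z ∈ Complex.sinh '' SincIndef.stripPos d, ‖f z‖ ≤ K * ‖SincIndef.E1 z β‖) :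
    MeasureTheory.Integrable (fun t : ℝ => f (t : ℂ)) ∧
    ∀ n : ℕ, 1 ≤ n →
      BddAbove (Set.range fun τ : ℝ =>
        ‖(∫ t in Set.Iic τ, f (t : ℂ)) -
          SincIndef.sincIndefSum f (SincIndef.meshSize d (min α β) n)
            (SincIndef.lowerTrunc α β n) (SincIndef.upperTrunc α β n) τ‖) ∧
      (⨆ τ : ℝ,
        ‖(∫ t in Set.Iic τ, f (t : ℂ)) -
          SincIndef.sincIndefSum f (SincIndef.meshSize d (min α β) n)
            (SincIndef.lowerTrunc α β n) (SincIndef.upperTrunc α β n) τ‖)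
        ≤ SincIndef.C1 d K α β * Real.exp (-√(Real.pi * d * min α β * n)) := by
  refine ⟨SincIndef.integrable_of_integrable_pullback f
    ((SincIndef.twoSidedExpDecay_pullback hd hd' hK hα hβ hneg hpos).integrable
      (SincIndef.continuous_pullback_ofReal hd hf) hα hβ), fun n hn => ?_⟩
  have key := SincIndef.norm_error_le hd hd' hK hα hβ hf hneg hpos n hn
  exact ⟨⟨_, Set.forall_mem_range.2 key⟩, ciSup_le key⟩
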